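/- **Theorem (Soundness and completeness of binding logic).** Let $\mathcal L$ be a language, that is, a set of function symbols and predicate symbols, each with a binding arity $\langle k_1,\dots,k_n\rangle$ (a finite sequence of natural numbers), and let $\mathcal V$ be an infinite set of variables. *Syntax.* Terms are variables and expressions $f(x^1_1\cdots x^1_{k_1}\,t_1,\dots,x^n_1\cdots x^n_{k_n}\,t_n)$, where $f$ is a function symbol of binding arity $\langle k_1,\dots,k_n\rangle$, the $t_i$ are terms, and the $x^i_j$ are distinct variables, $x^i_1,\dots,x^i_{k_i}$ being bound in $t_i$. Propositions are built from atoms $P(x^1_1\cdots x^1_{k_1}\,t_1,\dots,x^n_1\cdots x^n_{k_n}\,t_n)$, formed in the same way from a predicate symbol $P$, with $\Rightarrow,\wedge,\vee,\bot,\forall x,\exists x$. Terms and propositions are considered up to $\alpha$-equivalence, and $(t/x)A$ denotes capture-avoiding substitution. A sequent $\Gamma\vdash\Delta$ is a pair of finite multisets of propositions; it is *provable* if it is derivable by the rules of the classical sequent calculus (axiom $A\vdash A$, cut, contraction, weakening, the left and right rules of $\Rightarrow,\wedge,\vee,\forall,\exists$, and $\Gamma,\bot\vdash\Delta$), where the premise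 of $\forall$-left and $\exists$-right has $(t/x)A$ for an arbitrary term $t$, and $\forall$-right and $\exists$-left require that $x$ is not free in $\Gamma,\Delta$. *Models.* An intensional functional structure is a family of sets $M_0,M_1,\dots$ with elements $\mathbf 1_n,\dots,\mathbf n_n\in M_n$ and functions $\Box_{p,n}:M_n\times M_p^n\to M_p$ such that $\mathbf i_n\Box\langle a_1,\dots,a_n\rangle=a_i$, $\;a\Box\langle\mathbf 1_n,\dots,\mathbf n_n\rangle=a$, and $(a\Box\langle b_1,\dots,b_n\rangle)\Box c=a\Box\langle b_1\Box c,\dots,b_n\Box c\rangle$ for every tuple $c$. A binding model of $\mathcal L$ is such a structure with $M_0\neq\emptyset$, together with, for each function symbol $f$ of binding arity $\langle k_1,\dots,k_n\rangle$, functions $\hat f_p:\prod_{i=1}^n M_{p+k_i}\to M_p$ $(p\ge 0)$ such that, for all $p,q$, $a_i\in M_{p+k_i}$ and $b\in M_q^p$, $$\hat f_p(a_1,\dots,a_n)\,\Box_{q,p}\, b=\hat f_q\bigl(a_1\Box\Uparrow_{q,k_1,p}(b),\dots,a_n\Box\Uparrow_{q,k_n,p}(b)\bigr),$$ $$\Uparrow_{q,k,p}(b)=\langle\mathbf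 1_{q+k},\dots,\mathbf k_{q+k},b_1\Box S,\dots,b_p\Box S\rangle,\qquad S=\langle(\mathbf{1+k})_{q+k},\dots,(\mathbf{q+k})_{q+k}\rangle,$$ and, for each predicate symbol $P$ of binding arity $\langle k_1,\dots,k_n\rangle$, a function $\hat P:\prod_{i=1}^n M_{k_i}\to\{0,1\}$. *Denotation.* For an assignment $\varphi:\mathcal V\to M_0$ and variables $x_1,\dots,x_p$, the denotation $[\![t]\!]^{x_1,\dots,x_p}_\varphi\in M_p$ of a term is given by: $[\![x]\!]=\mathbf k_p$ if $k$ is the least index with $x_k=x$; $[\![y]\!]=\varphi(y)\,\Box_{p,0}\langle\rangle$ if $y$ is none of the $x_k$; and $[\![f(y^1_1\cdots y^1_{k_1}t_1,\dots,y^n_1\cdots y^n_{k_n}t_n)]\!]=\hat f_p(d_1,\dots,d_n)$ with $d_i=[\![t_i]\!]^{y^i_{k_i},\dots,y^i_1,x_1,\dots,x_p}_\varphi$. An atom $P(y^1_1\cdots y^1_{k_1}t_1,\dots,y^n_1\cdots y^n_{k_n}t_n)$ is true under $\varphi$ if $\hat P(d_1,\dots,d_n)=1$, where $d_i=[\![t_i]\!]^{y^i_{k_i},\dots,y^i_1}_\varphi$;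 the connectives are interpreted classically, and the quantifiers range over $M_0$. A proposition is *valid* in a model if it is true under every assignment; a model of $\Gamma$ is a binding model in which every proposition of $\Gamma$ is valid. Then a sequent $\Gamma\vdash\Delta$ of closed propositions is provable if and only if in every binding model of $\Gamma$ some proposition of $\Delta$ is valid. More generally, a sequent $\Gamma\vdash\Delta$ of arbitrary propositions is provable if and only if, for every binding model and every assignment $\varphi$ under which all propositions of $\Gamma$ are true, some proposition of $\Delta$ is true under $\varphi$. -/

import Mathlib

universe u v w

namespace BindingLogic

/-- A language: function and predicate symbols, each with a binding arity `⟨k₁, …, kₙ⟩`. -/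
structure Language where
  Func : Type u
  Pred : Type u
  funcArity : Func → List ℕ
  predArity : Pred → List ℕ

/-- The binder names `x¹₁ ⋯ x¹ₖ₁, …, xⁿ₁ ⋯ xⁿₖₙ` of one application of a symbol of binding arity
`k`; all of them, over all the arguments, are distinct. -/
structure Binders (k : List ℕ) (V : Type w) where
  name : (i : Fin k.length) → Fin (k.get i) → V
  distinct : Function.Injective fun p : (i : Fin k.length) × Fin (k.get i) => name p.1 p.2

/-- Terms, with named variables in `V`. `app f xs ts` is `f(x¹₁ ⋯ x¹ₖ₁ t₁, …, xⁿ₁ ⋯ xⁿₖₙ tₙ)`. -/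
inductive Term (L : Language.{u}) (V : Type w) : Type (max u w)
  | var (x : V) : Term L V
  | app (f : L.Func) (xs : Binders (L.funcArity f) V)
      (ts : Fin (L.funcArity f).length → Term L V) : Term L V

/-- Propositions. `atom P xs ts` is `P(x¹₁ ⋯ x¹ₖ₁ t₁, …, xⁿ₁ ⋯ xⁿₖₙ tₙ)`. -/
inductive Formula (L : Language.{u}) (V : Type w) : Type (max u w)
  | atom (P : L.Pred) (xs : Binders (L.predArity P) V)
      (ts : Fin (L.predArity P).length → Term L V) : Formula L V
  | imp (A B : Formula L V) : Formula L V
  | and (A B : Formula L V) : Formula L V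
  | or (A B : Formula L V) : Formula L V
  | bot : Formula L V
  | all (x : V) (A : Formula L V) : Formula L V
  | ex (x : V) (A : Formula L V) : Formula L V

section Syntactic

variable {L : Language.{u}} {V : Type w}

/-- The variables that appear, free or bound (binder names included), in a term. -/
def Term.vars : Term L V → Set V
  | .var x => {x}
  | .app _ xs ts => ⋃ i, Set.range (xs.name i) ∪ (ts i).vars

/-- The free variables of a term. -/
def Term.freeVars : Term L V → Set V
  | .var x => {x}
  | .app _ xs ts => ⋃ i, (ts i).freeVars \ Set.range (xs.name i)

/-- The variables that appear, free or bound (binder names included), in a proposition. -/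
def Formula.vars : Formula L V → Set V
  | .atom _ xs ts => ⋃ i, Set.range (xs.name i) ∪ (ts i).vars
  | .imp A B => A.vars ∪ B.vars
  | .and A B => A.vars ∪ B.vars
  | .or A B => A.vars ∪ B.vars
  | .bot => ∅
  | .all x A => {x} ∪ A.vars
  | .ex x A => {x} ∪ A.vars

/-- The free variables of a proposition. -/
def Formula.freeVars : Formula L V → Set V
  | .atom _ xs ts => ⋃ i, (ts i).freeVars \ Set.range (xs.name i)
  | .imp A B => A.freeVars ∪ B.freeVars
  | .and A B => A.freeVars ∪ B.freeVars
  | .or A B => A.freeVars ∪ B.freeVars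
  | .bot => ∅
  | .all x A => A.freeVars \ {x}
  | .ex x A => A.freeVars \ {x}

/-- The map `y₁/x₁, …, yₖ/xₖ`, as a map on all variables that is the identity elsewhere. -/
noncomputable def renameMap {k : ℕ} (ys xs : Fin k → V) : V → Term L V :=
  Function.extend xs (fun j => Term.var (ys j)) Term.var

open scoped Classical in
/-- The restriction of `θ` to the complement of `S`; as maps are total here, it is the identity
on `S`. -/
noncomputable def restrict (S : Set V) (θ : V → Term L V) : V → Term L V :=
  fun z => if z ∈ S then Term.var z else θ z

/-- Grafting `⟨θ⟩t`: replacement of the free variables, with possible captures. -/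
noncomputable def Term.graft (θ : V → Term L V) : Term L V → Term L V
  | .var x => θ x
  | .app f xs ts =>
      .app f xs fun i => Term.graft (restrict (Set.range (xs.name i)) θ) (ts i)

/-- Grafting `⟨θ⟩A` in a proposition. -/
noncomputable def Formula.graft (θ : V → Term L V) : Formula L V → Formula L V
  | .atom P xs ts =>
      .atom P xs fun i => Term.graft (restrict (Set.range (xs.name i)) θ) (ts i)
  | .imp A B => .imp (A.graft θ) (B.graft θ)
  | .and A B => .and (A.graft θ) (B.graft θ)
  | .or A B => .or (A.graft θ) (B.graft θ)
  | .bot => .bot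
  | .all x A => .all x (Formula.graft (restrict {x} θ) A)
  | .ex x A => .ex x (Formula.graft (restrict {x} θ) A)

/-- `α`-equivalence of terms. -/
inductive Term.Alpha : Term L V → Term L V → Prop
  | var (x : V) : Term.Alpha (.var x) (.var x)
  | app (f : L.Func) (xs xs' : Binders (L.funcArity f) V)
      (ts ts' : Fin (L.funcArity f).length → Term L V)
      (ys : (i : Fin (L.funcArity f).length) → Fin ((L.funcArity f).get i) → V)
      (distinct : ∀ i, Function.Injective (ys i))
      (fresh : ∀ i j, ys i j ∉ (ts i).vars ∧ ys i j ∉ (ts' i).vars)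
      (h : ∀ i, Term.Alpha ((ts i).graft (renameMap (ys i) (xs.name i)))
        ((ts' i).graft (renameMap (ys i) (xs'.name i)))) :
      Term.Alpha (.app f xs ts) (.app f xs' ts')

/-- `α`-equivalence of propositions. -/
inductive Formula.Alpha : Formula L V → Formula L V → Prop
  | atom (P : L.Pred) (xs xs' : Binders (L.predArity P) V)
      (ts ts' : Fin (L.predArity P).length → Term L V)
      (ys : (i : Fin (L.predArity P).length) → Fin ((L.predArity P).get i) → V)
      (distinct : ∀ i, Function.Injective (ys i))
      (fresh : ∀ i j, ys i j ∉ (ts i).vars ∧ ys i j ∉ (ts' i).vars)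
      (h : ∀ i, Term.Alpha ((ts i).graft (renameMap (ys i) (xs.name i)))
        ((ts' i).graft (renameMap (ys i) (xs'.name i)))) :
      Formula.Alpha (.atom P xs ts) (.atom P xs' ts')
  | imp {A A' B B' : Formula L V} : Formula.Alpha A A' → Formula.Alpha B B' →
      Formula.Alpha (.imp A B) (.imp A' B')
  | and {A A' B B' : Formula L V} : Formula.Alpha A A' → Formula.Alpha B B' →
      Formula.Alpha (.and A B) (.and A' B')
  | or {A A' B B' : Formula L V} : Formula.Alpha A A' → Formula.Alpha B B' →
      Formula.Alpha (.or A B) (.or A' B')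
  | bot : Formula.Alpha .bot .bot
  | all (x x' y : V) (A A' : Formula L V) (fresh : y ∉ A.vars ∧ y ∉ A'.vars)
      (h : Formula.Alpha (A.graft (renameMap ![y] ![x])) (A'.graft (renameMap ![y] ![x']))) :
      Formula.Alpha (.all x A) (.all x' A')
  | ex (x x' y : V) (A A' : Formula L V) (fresh : y ∉ A.vars ∧ y ∉ A'.vars)
      (h : Formula.Alpha (A.graft (renameMap ![y] ![x])) (A'.graft (renameMap ![y] ![x']))) :
      Formula.Alpha (.ex x A) (.ex x' A')

/-- `Term.IsSubst t x u u'`: the term `u'` is a result of the capture-avoiding substitution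
`(t/x)u`. It is a relation, because the fresh names of the bound variables are arbitrary; the
result is determined up to `α`-equivalence. -/
inductive Term.IsSubst (t : Term L V) (x : V) : Term L V → Term L V → Prop
  | var_self : Term.IsSubst t x (.var x) t
  | var_other (z : V) (h : z ≠ x) : Term.IsSubst t x (.var z) (.var z)
  | app (f : L.Func) (xs ys : Binders (L.funcArity f) V)
      (us us' : Fin (L.funcArity f).length → Term L V)
      (fresh : ∀ i j, ys.name i j ∉ (Term.app f xs us).vars ∧ ys.name i j ∉ t.vars ∧
        ys.name i j ≠ x)
      (h : ∀ i, Term.IsSubst t x ((us i).graft (renameMap (ys.name i) (xs.name i))) (us' i)) :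
      Term.IsSubst t x (.app f xs us) (.app f ys us')

/-- `Formula.IsSubst t x A A'`: the proposition `A'` is a result of the capture-avoiding
substitution `(t/x)A`. -/
inductive Formula.IsSubst (t : Term L V) (x : V) : Formula L V → Formula L V → Prop
  | atom (P : L.Pred) (xs ys : Binders (L.predArity P) V)
      (us us' : Fin (L.predArity P).length → Term L V)
      (fresh : ∀ i j, ys.name i j ∉ (Formula.atom P xs us).vars ∧ ys.name i j ∉ t.vars ∧
        ys.name i j ≠ x)
      (h : ∀ i, Term.IsSubst t x ((us i).graft (renameMap (ys.name i) (xs.name i))) (us' i)) :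
      Formula.IsSubst t x (.atom P xs us) (.atom P ys us')
  | imp {A A' B B' : Formula L V} : Formula.IsSubst t x A A' → Formula.IsSubst t x B B' →
      Formula.IsSubst t x (.imp A B) (.imp A' B')
  | and {A A' B B' : Formula L V} : Formula.IsSubst t x A A' → Formula.IsSubst t x B B' →
      Formula.IsSubst t x (.and A B) (.and A' B')
  | or {A A' B B' : Formula L V} : Formula.IsSubst t x A A' → Formula.IsSubst t x B B' →
      Formula.IsSubst t x (.or A B) (.or A' B')
  | bot : Formula.IsSubst t x .bot .bot
  | all (z y : V) (A A' : Formula L V)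
      (fresh : y ∉ (Formula.all z A).vars ∧ y ∉ t.vars ∧ y ≠ x)
      (h : Formula.IsSubst t x (A.graft (renameMap ![y] ![z])) A') :
      Formula.IsSubst t x (.all z A) (.all y A')
  | ex (z y : V) (A A' : Formula L V)
      (fresh : y ∉ (Formula.ex z A).vars ∧ y ∉ t.vars ∧ y ≠ x)
      (h : Formula.IsSubst t x (A.graft (renameMap ![y] ![z])) A') :
      Formula.IsSubst t x (.ex z A) (.ex y A')

/-- `Provable Γ Δ`: the sequent `Γ ⊢ Δ` has a proof in the sequent calculus of binding logic.
Propositions are considered up to `α`-equivalence, which is what the rule `alpha` says; all the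
other rules are those of predicate logic. -/
inductive Provable : Multiset (Formula L V) → Multiset (Formula L V) → Prop
  | alpha {Γ Γ' Δ Δ' : Multiset (Formula L V)} :
      Multiset.Rel Formula.Alpha Γ Γ' → Multiset.Rel Formula.Alpha Δ Δ' →
      Provable Γ Δ → Provable Γ' Δ'
  | ax (A : Formula L V) : Provable {A} {A}
  | cut {Γ Δ : Multiset (Formula L V)} (A : Formula L V) :
      Provable (A ::ₘ Γ) Δ → Provable Γ (A ::ₘ Δ) → Provable Γ Δ
  | contrLeft {Γ Δ : Multiset (Formula L V)} {A : Formula L V} :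
      Provable (A ::ₘ A ::ₘ Γ) Δ → Provable (A ::ₘ Γ) Δ
  | contrRight {Γ Δ : Multiset (Formula L V)} {A : Formula L V} :
      Provable Γ (A ::ₘ A ::ₘ Δ) → Provable Γ (A ::ₘ Δ)
  | weakLeft {Γ Δ : Multiset (Formula L V)} {A : Formula L V} :
      Provable Γ Δ → Provable (A ::ₘ Γ) Δ
  | weakRight {Γ Δ : Multiset (Formula L V)} {A : Formula L V} :
      Provable Γ Δ → Provable Γ (A ::ₘ Δ)
  | impLeft {Γ Δ : Multiset (Formula L V)} {A B : Formula L V} :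
      Provable Γ (A ::ₘ Δ) → Provable (B ::ₘ Γ) Δ → Provable (.imp A B ::ₘ Γ) Δ
  | impRight {Γ Δ : Multiset (Formula L V)} {A B : Formula L V} :
      Provable (A ::ₘ Γ) (B ::ₘ Δ) → Provable Γ (.imp A B ::ₘ Δ)
  | andLeft {Γ Δ : Multiset (Formula L V)} {A B : Formula L V} :
      Provable (A ::ₘ B ::ₘ Γ) Δ → Provable (.and A B ::ₘ Γ) Δ
  | andRight {Γ Δ : Multiset (Formula L V)} {A B : Formula L V} :
      Provable Γ (A ::ₘ Δ) → Provable Γ (B ::ₘ Δ) → Provable Γ (.and A B ::ₘ Δ)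
  | orLeft {Γ Δ : Multiset (Formula L V)} {A B : Formula L V} :
      Provable (A ::ₘ Γ) Δ → Provable (B ::ₘ Γ) Δ → Provable (.or A B ::ₘ Γ) Δ
  | orRight {Γ Δ : Multiset (Formula L V)} {A B : Formula L V} :
      Provable Γ (A ::ₘ B ::ₘ Δ) → Provable Γ (.or A B ::ₘ Δ)
  | botLeft {Γ Δ : Multiset (Formula L V)} : Provable (.bot ::ₘ Γ) Δ
  | allLeft {Γ Δ : Multiset (Formula L V)} {x : V} {A A' : Formula L V} (t : Term L V) :
      Formula.IsSubst t x A A' → Provable (A' ::ₘ Γ) Δ → Provable (.all x A ::ₘ Γ) Δ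
  | allRight {Γ Δ : Multiset (Formula L V)} {x : V} {A : Formula L V} :
      (∀ B ∈ Γ, x ∉ B.freeVars) → (∀ B ∈ Δ, x ∉ B.freeVars) →
      Provable Γ (A ::ₘ Δ) → Provable Γ (.all x A ::ₘ Δ)
  | exLeft {Γ Δ : Multiset (Formula L V)} {x : V} {A : Formula L V} :
      (∀ B ∈ Γ, x ∉ B.freeVars) → (∀ B ∈ Δ, x ∉ B.freeVars) →
      Provable (A ::ₘ Γ) Δ → Provable (.ex x A ::ₘ Γ) Δ
  | exRight {Γ Δ : Multiset (Formula L V)} {x : V} {A A' : Formula L V} (t : Term L V) :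
      Formula.IsSubst t x A A' → Provable Γ (A' ::ₘ Δ) → Provable Γ (.ex x A ::ₘ Δ)

end Syntactic

/-- Intensional functional structures. `proj i` is the projection `𝐢ₙ` (numbered from `0`) and
`comp a b` is `a □_{p,n} ⟨b₁, …, bₙ⟩`. -/
structure IntensionalStructure where
  carrier : ℕ → Type v
  proj : {n : ℕ} → Fin n → carrier n
  comp : {n p : ℕ} → carrier n → (Fin n → carrier p) → carrier p
  proj_comp : ∀ {n p : ℕ} (i : Fin n) (a : Fin n → carrier p), comp (proj i) a = a i
  comp_proj : ∀ {n : ℕ} (a : carrier n), comp a proj = a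
  comp_assoc : ∀ {n p q : ℕ} (a : carrier n) (b : Fin n → carrier p) (c : Fin p → carrier q),
    comp (comp a b) c = comp a fun i => comp (b i) c

/-- The tuple `⇑_{q,k,p}⟨b₁, …, b_p⟩ = ⟨𝟏, …, 𝐤, b₁ □ S, …, b_p □ S⟩` over `M_{k+q}`, where
`S = ⟨𝐤+𝟏, …, 𝐤+𝐪⟩`. -/
def IntensionalStructure.lift (M : IntensionalStructure.{v}) {p q : ℕ} (k : ℕ)
    (b : Fin p → M.carrier q) : Fin (k + p) → M.carrier (k + q) :=
  Fin.append (fun j : Fin k => M.proj (Fin.castAdd q j))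
    fun j : Fin p => M.comp (b j) fun l : Fin q => M.proj (Fin.natAdd k l)

/-- Binding models of a language: `func f p` is `f̂_p`, and `pred P` is `P̂`. -/
structure BindingModel (L : Language.{u}) extends IntensionalStructure.{v} where
  func : (f : L.Func) → (p : ℕ) →
    ((i : Fin (L.funcArity f).length) → carrier ((L.funcArity f).get i + p)) → carrier p
  func_comp : ∀ (f : L.Func) (p q : ℕ)
    (a : (i : Fin (L.funcArity f).length) → carrier ((L.funcArity f).get i + p))
    (b : Fin p → carrier q),
    comp (func f p a) b =
      func f q fun i => comp (a i) (toIntensionalStructure.lift ((L.funcArity f).get i) b)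
  pred : (P : L.Pred) →
    ((i : Fin (L.predArity P).length) → carrier ((L.predArity P).get i)) → Prop

section Semantics

variable {L : Language.{u}} {V : Type w}

open scoped Classical in
/-- The denotation `⟦t⟧_φ^{x₁, …, x_p}`, an element of `M_p`. A variable that is listed several
times in `x₁, …, x_p` denotes the projection of its first place, which is that of the innermost
binder. -/
noncomputable def BindingModel.termDen (M : BindingModel.{u, v} L) (φ : V → M.carrier 0) :
    Term L V → {p : ℕ} → (Fin p → V) → M.carrier p
  | .var x, _, xs =>
      if h : ∃ j, xs j = x then M.proj (Fin.find (fun j => xs j = x) h)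
      else M.comp (φ x) Fin.elim0
  | .app f ys ts, p, xs =>
      M.func f p fun i => termDen M φ (ts i) (Fin.append (fun j => ys.name i j.rev) xs)

open scoped Classical in
/-- `M.Sat φ A` says `⟦A⟧_φ = 1`. -/
def BindingModel.Sat (M : BindingModel.{u, v} L) (φ : V → M.carrier 0) : Formula L V → Prop
  | .atom P ys ts => M.pred P fun i => M.termDen φ (ts i) fun j => ys.name i j.rev
  | .imp A B => Sat M φ A → Sat M φ B
  | .and A B => Sat M φ A ∧ Sat M φ B
  | .or A B => Sat M φ A ∨ Sat M φ B
  | .bot => False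
  | .all x A => ∀ a : M.carrier 0, Sat M (Function.update φ x a) A
  | .ex x A => ∃ a : M.carrier 0, Sat M (Function.update φ x a) A

/-- A proposition is valid in a model if it is true under every assignment. -/
def BindingModel.Valid (M : BindingModel.{u, v} L) (A : Formula L V) : Prop :=
  ∀ φ : V → M.carrier 0, M.Sat φ A

end Semantics

end BindingLogic

/-!
Soundness. Evaluating a term in an environment, a map from all variables to `M_p`, instead of under
a list of bound variables, makes grafting and substitution compatible with the denotation as long as
no variable is captured; invariance under `α`-equivalence follows, and the rules are then sound one
by one.

Completeness. Let `Γ ⊢ Δ` be unprovable. It mentions finitely many symbols and variables, so the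
language and the set of variables can be taken countable. In the order of unprovable sequents, those
that decide a given proposition, with a fresh variable as a witness of an existential one on the
left or as a counterexample to a universal one on the right, are cofinal: this is the cut rule. An
ideal that meets all of these cofinal sets is therefore a Henkin theory. In its term model the
elements of `M_n` are the de Bruijn terms with `n` indices. Two named terms are `α`-equivalent when
they have the same value there, so that atoms can be interpreted by membership in the theory, and
every element of `M_0` is the value of a named term, so that truth under the assignment `x ↦ x` is
membership in the theory, for all propositions. A countermodel for the sublanguage expands to the
whole language by interpreting the other function symbols by a constant.
-/

namespace BindingLogic

/-! ### Soundness -/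

section Soundness

variable {L : Language.{u}} {V : Type w}

theorem Binders.name_injective {k : List ℕ} (xs : Binders k V) (i : Fin k.length) :
    Function.Injective (xs.name i) := fun a b h => by
  simpa using @xs.distinct ⟨i, a⟩ ⟨i, b⟩ h

theorem Term.freeVars_subset_vars (t : Term L V) : t.freeVars ⊆ t.vars := by
  induction t with
  | var x => exact subset_rfl
  | app f ys ts ih => exact Set.iUnion_mono fun i x hx => Or.inr (ih i hx.1)

theorem Formula.freeVars_subset_vars (A : Formula L V) : A.freeVars ⊆ A.vars := by
  induction A with
  | atom P ys ts => exact Set.iUnion_mono fun i x hx => Or.inr ((ts i).freeVars_subset_vars hx.1)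
  | imp A B ihA ihB => exact Set.union_subset_union ihA ihB
  | and A B ihA ihB => exact Set.union_subset_union ihA ihB
  | or A B ihA ihB => exact Set.union_subset_union ihA ihB
  | bot => exact subset_rfl
  | all x A ih => exact fun y hy => Or.inr (ih hy.1)
  | ex x A ih => exact fun y hy => Or.inr (ih hy.1)

/-- The map `θ` moves no variable to a term that has a free variable in `S`; grafting `θ` in an
expression all of whose variables are in `S` captures nothing. -/
def Avoids (θ : V → Term L V) (S : Set V) : Prop :=
  ∀ x, θ x = .var x ∨ ∀ z ∈ (θ x).freeVars, z ∉ S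

theorem Avoids.mono {θ : V → Term L V} {S T : Set V} (h : Avoids θ T) (hS : S ⊆ T) :
    Avoids θ S := fun x => (h x).imp_right fun h z hz hzS => h z hz (hS hzS)

theorem Avoids.restrict {θ : V → Term L V} {S : Set V} (h : Avoids θ S) (R : Set V) :
    Avoids (restrict R θ) S := by
  intro x
  by_cases hx : x ∈ R
  · exact Or.inl (if_pos hx)
  · simpa only [BindingLogic.restrict, if_neg hx] using h x

theorem renameMap_name {k : ℕ} (ys : Fin k → V) {xs : Fin k → V} (hx : Function.Injective xs)
    (j : Fin k) : (renameMap ys xs (xs j) : Term L V) = .var (ys j) :=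
  hx.extend_apply _ _ j

theorem renameMap_of_notMem {k : ℕ} (ys : Fin k → V) {xs : Fin k → V} {x : V}
    (hx : x ∉ Set.range xs) : (renameMap ys xs x : Term L V) = .var x :=
  Function.extend_apply' _ _ _ hx

theorem injective_vec_one (x : V) : Function.Injective ![x] := fun a b _ => Subsingleton.elim a b

theorem renameMap_vec_self (y x : V) : (renameMap ![y] ![x] x : Term L V) = .var y :=
  renameMap_name ![y] (injective_vec_one x) 0

theorem renameMap_vec_of_ne (y : V) {x z : V} (h : z ≠ x) :
    (renameMap ![y] ![x] z : Term L V) = .var z :=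
  renameMap_of_notMem _ (by simpa using h)

theorem avoids_renameMap {k : ℕ} {ys xs : Fin k → V} {S : Set V} (hx : Function.Injective xs)
    (h : ∀ j, ys j ∉ S) : Avoids (L := L) (renameMap ys xs) S := by
  intro x
  by_cases hxs : x ∈ Set.range xs
  · obtain ⟨j, rfl⟩ := hxs
    rw [renameMap_name _ hx]
    exact Or.inr fun z hz => hz ▸ h j
  · exact Or.inl (renameMap_of_notMem _ hxs)

namespace BindingModel

variable (M : BindingModel.{u, v} L)

/-- The extension to level `k + p` of an environment of level `p` under the binders `ys`. The
binders are listed in reverse, as in the denotation of a term, the innermost one being last. -/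
noncomputable def ext {p k : ℕ} (ρ : V → M.carrier p) (ys : Fin k → V) : V → M.carrier (k + p) :=
  Function.extend ys (fun j => M.proj (Fin.castAdd p j.rev))
    fun x => M.comp (ρ x) fun l => M.proj (Fin.natAdd k l)

/-- The value of a term in an environment of level `p`, a map that gives a value in `M_p` to every
variable: this is the denotation, with the list of bound variables absorbed in the environment. -/
noncomputable def eval : Term L V → {p : ℕ} → (V → M.carrier p) → M.carrier p
  | .var x, _, ρ => ρ x
  | .app f ys ts, p, ρ => M.func f p fun i => eval (ts i) (M.ext ρ (ys.name i))

/-- The environment of an assignment `φ` and a list `xs` of bound variables. -/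
noncomputable def env (φ : V → M.carrier 0) {p : ℕ} (xs : Fin p → V) (x : V) : M.carrier p :=
  M.termDen φ (.var x) xs

theorem ext_name {p k : ℕ} (ρ : V → M.carrier p) {ys : Fin k → V} (hy : Function.Injective ys)
    (j : Fin k) : M.ext ρ ys (ys j) = M.proj (Fin.castAdd p j.rev) :=
  hy.extend_apply _ _ j

theorem ext_of_notMem {p k : ℕ} (ρ : V → M.carrier p) {ys : Fin k → V} {x : V}
    (hx : x ∉ Set.range ys) : M.ext ρ ys x = M.comp (ρ x) fun l => M.proj (Fin.natAdd k l) :=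
  Function.extend_apply' _ _ _ hx

theorem ext_congr {p k : ℕ} {ρ ρ' : V → M.carrier p} {ys : Fin k → V} (hy : Function.Injective ys)
    {x : V} (h : x ∉ Set.range ys → ρ x = ρ' x) : M.ext ρ ys x = M.ext ρ' ys x := by
  by_cases hx : x ∈ Set.range ys
  · obtain ⟨j, rfl⟩ := hx
    rw [M.ext_name _ hy, M.ext_name _ hy]
  · rw [M.ext_of_notMem _ hx, M.ext_of_notMem _ hx, h hx]

theorem comp_elim0 (a : M.carrier 0) : M.comp a Fin.elim0 = a := by
  rw [Subsingleton.elim Fin.elim0 M.proj, M.comp_proj]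

theorem env_of_isLeast {φ : V → M.carrier 0} {p : ℕ} {xs : Fin p → V} {x : V} {j : Fin p}
    (hj : xs j = x) (hmin : ∀ i < j, xs i ≠ x) : M.env φ xs x = M.proj j := by
  classical
  rw [env, termDen, dif_pos ⟨j, hj⟩]
  congr 1
  rw [Fin.find_eq_iff]
  exact ⟨hj, hmin⟩

theorem env_of_notMem {φ : V → M.carrier 0} {p : ℕ} {xs : Fin p → V} {x : V}
    (hx : x ∉ Set.range xs) : M.env φ xs x = M.comp (φ x) Fin.elim0 := by
  rw [env, termDen, dif_neg (show ¬ ∃ j, xs j = x from hx)]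

theorem env_elim0 (φ : V → M.carrier 0) (xs : Fin 0 → V) : M.env φ xs = φ :=
  funext fun x => by rw [M.env_of_notMem fun ⟨j, _⟩ => j.elim0, M.comp_elim0]

theorem env_append (φ : V → M.carrier 0) {p k : ℕ} (xs : Fin p → V) {ys : Fin k → V}
    (hy : Function.Injective ys) :
    M.env φ (Fin.append (fun j => ys j.rev) xs) = M.ext (M.env φ xs) ys := by
  classical
  funext x
  by_cases hx : x ∈ Set.range ys
  · obtain ⟨j, rfl⟩ := hx
    rw [M.ext_name _ hy]
    refine M.env_of_isLeast (by simp) fun i hi => ?_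
    induction i using Fin.addCases with
    | left i =>
      rw [Fin.append_left, hy.ne_iff, Ne, Fin.rev_eq_iff]
      exact ne_of_lt hi
    | right i =>
      exact absurd (Fin.lt_def.1 hi) (j.rev.isLt.trans_le (Nat.le_add_right k i)).not_gt
  rw [M.ext_of_notMem _ hx]
  have hleft (i : Fin k) : ys i.rev ≠ x := fun h => hx ⟨_, h⟩
  by_cases h : ∃ j, xs j = x
  · rw [M.env_of_isLeast (Fin.find_spec h) fun i => Fin.find_min h, M.proj_comp]
    refine M.env_of_isLeast (by simpa using Fin.find_spec h) fun i hi => ?_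
    induction i using Fin.addCases with
    | left i => rw [Fin.append_left]; exact hleft i
    | right i =>
      rw [Fin.append_right]
      exact Fin.find_min h (by simpa [Fin.lt_def] using hi)
  · rw [M.env_of_notMem h, M.comp_assoc, M.env_of_notMem, Subsingleton.elim Fin.elim0]
    rintro ⟨i, hi⟩
    induction i using Fin.addCases with
    | left i => exact hleft i (by simpa using hi)
    | right i => exact h ⟨i, by simpa using hi⟩

theorem termDen_eq_eval (φ : V → M.carrier 0) (t : Term L V) {p : ℕ} (xs : Fin p → V) :
    M.termDen φ t xs = M.eval t (M.env φ xs) := by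
  induction t generalizing p with
  | var x => rfl
  | app f ys ts ih =>
    simp only [termDen, eval]
    congr 1
    funext i
    rw [ih, M.env_append φ xs (ys.name_injective i)]

theorem sat_atom (φ : V → M.carrier 0) (P : L.Pred) (ys : Binders (L.predArity P) V)
    (ts : Fin (L.predArity P).length → Term L V) :
    M.Sat φ (.atom P ys ts) ↔ M.pred P fun i => M.eval (ts i) (M.ext φ (ys.name i)) := by
  have henv (i) : M.env φ (fun j => ys.name i j.rev) = M.ext φ (ys.name i) := by
    rw [← M.env_elim0 φ Fin.elim0, ← M.env_append φ _ (ys.name_injective i), M.env_elim0,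
      Fin.append_elim0, Fin.cast_refl]
    rfl
  simp only [Sat, termDen_eq_eval, henv]

theorem eval_congr (t : Term L V) {p : ℕ} {ρ ρ' : V → M.carrier p}
    (h : ∀ x ∈ t.freeVars, ρ x = ρ' x) : M.eval t ρ = M.eval t ρ' := by
  induction t generalizing p with
  | var x => exact h x rfl
  | app f ys ts ih =>
    simp only [eval]
    congr 1
    exact funext fun i => ih i fun x hx => M.ext_congr (ys.name_injective i) fun hxy =>
      h x (Set.mem_iUnion.2 ⟨i, hx, hxy⟩)

theorem ext_comp {p q k : ℕ} (ρ : V → M.carrier p) {ys : Fin k → V} (hy : Function.Injective ys)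
    (b : Fin p → M.carrier q) (x : V) :
    M.comp (M.ext ρ ys x) (M.lift k b) = M.ext (fun z => M.comp (ρ z) b) ys x := by
  by_cases hx : x ∈ Set.range ys
  · obtain ⟨j, rfl⟩ := hx
    rw [M.ext_name _ hy, M.ext_name _ hy, M.proj_comp, IntensionalStructure.lift, Fin.append_left]
  · simp only [M.ext_of_notMem _ hx, M.comp_assoc, M.proj_comp, IntensionalStructure.lift,
      Fin.append_right]

theorem eval_comp (t : Term L V) {p q : ℕ} (ρ : V → M.carrier p) (b : Fin p → M.carrier q) :
    M.comp (M.eval t ρ) b = M.eval t fun x => M.comp (ρ x) b := by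
  induction t generalizing p q with
  | var x => rfl
  | app f ys ts ih => simp only [eval, M.func_comp, ih, M.ext_comp _ (ys.name_injective _)]

theorem eval_ext_of_notMem {p k : ℕ} (t : Term L V) (ρ : V → M.carrier p) {ys : Fin k → V}
    (h : ∀ j, ys j ∉ t.freeVars) :
    M.eval t (M.ext ρ ys) = M.comp (M.eval t ρ) fun l => M.proj (Fin.natAdd k l) := by
  rw [M.eval_comp]
  refine M.eval_congr t fun x hx => M.ext_of_notMem _ ?_
  rintro ⟨j, rfl⟩
  exact h j hx

theorem eval_restrict_ext {p k : ℕ} {θ : V → Term L V} {ys : Fin k → V}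
    (hy : Function.Injective ys) (h : Avoids θ (Set.range ys)) (ρ : V → M.carrier p) (x : V) :
    M.eval (restrict (Set.range ys) θ x) (M.ext ρ ys) =
      M.ext (fun z => M.eval (θ z) ρ) ys x := by
  by_cases hx : x ∈ Set.range ys
  · rw [restrict, if_pos hx]
    obtain ⟨j, rfl⟩ := hx
    rw [M.ext_name _ hy, eval, M.ext_name _ hy]
  · rw [restrict, if_neg hx, M.ext_of_notMem _ hx]
    refine M.eval_ext_of_notMem _ _ fun j hj => ?_
    rcases h x with h | h
    · rw [h] at hj
      exact hx ⟨j, hj⟩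
    · exact h _ hj ⟨j, rfl⟩

theorem eval_graft (t : Term L V) {p : ℕ} (ρ : V → M.carrier p) {θ : V → Term L V}
    (h : Avoids θ t.vars) : M.eval (t.graft θ) ρ = M.eval t fun x => M.eval (θ x) ρ := by
  induction t generalizing p θ with
  | var x => rfl
  | app f ys ts ih =>
    have hys (i) : Avoids θ (Set.range (ys.name i) ∪ (ts i).vars) :=
      h.mono (Set.subset_iUnion_of_subset i subset_rfl)
    simp only [eval, Term.graft]
    congr 1
    funext i
    rw [ih i _ (((hys i).mono Set.subset_union_right).restrict _)]
    simp only [M.eval_restrict_ext (ys.name_injective i) ((hys i).mono Set.subset_union_left)]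

theorem eval_graft_renameMap {p k : ℕ} (t : Term L V) (ρ : V → M.carrier p) {ys xs : Fin k → V}
    (hy : Function.Injective ys) (hx : Function.Injective xs) (h : ∀ j, ys j ∉ t.vars) :
    M.eval (t.graft (renameMap ys xs)) (M.ext ρ ys) = M.eval t (M.ext ρ xs) := by
  rw [M.eval_graft t _ (avoids_renameMap hx h)]
  refine M.eval_congr t fun z hz => ?_
  by_cases hxs : z ∈ Set.range xs
  · obtain ⟨j, rfl⟩ := hxs
    rw [renameMap_name _ hx, eval, M.ext_name _ hy, M.ext_name _ hx]
  · rw [renameMap_of_notMem _ hxs, eval, M.ext_of_notMem _ hxs, M.ext_of_notMem]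
    rintro ⟨j, rfl⟩
    exact h j (t.freeVars_subset_vars hz)

theorem eval_alpha {t t' : Term L V} (h : t.Alpha t') {p : ℕ} (ρ : V → M.carrier p) :
    M.eval t ρ = M.eval t' ρ := by
  induction h generalizing p with
  | var x => rfl
  | app f xs xs' ts ts' ys hy fresh _ ih =>
    simp only [eval]
    congr 1
    funext i
    rw [← M.eval_graft_renameMap (ts i) ρ (hy i) (xs.name_injective i) fun j => (fresh i j).1, ih,
      M.eval_graft_renameMap (ts' i) ρ (hy i) (xs'.name_injective i) fun j => (fresh i j).2]

open scoped Classical in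
theorem eval_update_graft_renameMap {p k : ℕ} (t u : Term L V) (x : V) (ρ : V → M.carrier p)
    {ys xs : Fin k → V} (hy : Function.Injective ys) (hx : Function.Injective xs)
    (hu : ∀ j, ys j ∉ u.vars) (ht : ∀ j, ys j ∉ t.vars) (hne : ∀ j, ys j ≠ x) :
    M.eval (u.graft (renameMap ys xs))
        (Function.update (M.ext ρ ys) x (M.eval t (M.ext ρ ys))) =
      M.eval u (M.ext (Function.update ρ x (M.eval t ρ)) xs) := by
  rw [← M.eval_graft_renameMap u _ hy hx hu]
  congr 1
  funext z
  by_cases hz : z ∈ Set.range ys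
  · obtain ⟨j, rfl⟩ := hz
    rw [Function.update_of_ne (hne j), M.ext_name _ hy, M.ext_name _ hy]
  rw [M.ext_of_notMem _ hz]
  rcases eq_or_ne z x with rfl | hzx
  · rw [Function.update_self, Function.update_self, M.eval_ext_of_notMem]
    exact fun j hj => ht j (t.freeVars_subset_vars hj)
  · rw [Function.update_of_ne hzx, Function.update_of_ne hzx, M.ext_of_notMem _ hz]

open scoped Classical in
theorem eval_isSubst {t : Term L V} {x : V} {u u' : Term L V} (h : Term.IsSubst t x u u') {p : ℕ}
    (ρ : V → M.carrier p) : M.eval u' ρ = M.eval u (Function.update ρ x (M.eval t ρ)) := by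
  induction h generalizing p with
  | var_self => rw [eval, Function.update_self]
  | var_other z h => rw [eval, eval, Function.update_of_ne h]
  | app f xs ys us us' fresh _ ih =>
    simp only [eval]
    congr 1
    funext i
    rw [ih, M.eval_update_graft_renameMap t (us i) x ρ (ys.name_injective i) (xs.name_injective i)
      (fun j hj => (fresh i j).1 (Set.mem_iUnion.2 ⟨i, Or.inr hj⟩))
      (fun j => (fresh i j).2.1) (fun j => (fresh i j).2.2)]

open scoped Classical in
theorem sat_congr (A : Formula L V) {φ φ' : V → M.carrier 0}
    (h : ∀ x ∈ A.freeVars, φ x = φ' x) : M.Sat φ A ↔ M.Sat φ' A := by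
  have update_congr {S : Set V} {x : V} {φ φ' : V → M.carrier 0} (h : ∀ z ∈ S \ {x}, φ z = φ' z)
      (a : M.carrier 0) : ∀ z ∈ S, Function.update φ x a z = Function.update φ' x a z := by
    intro z hz
    rcases eq_or_ne z x with rfl | hzx
    · rw [Function.update_self, Function.update_self]
    · rw [Function.update_of_ne hzx, Function.update_of_ne hzx, h z ⟨hz, hzx⟩]
  induction A generalizing φ φ' with
  | atom P ys ts =>
    rw [M.sat_atom, M.sat_atom]
    refine iff_of_eq (congrArg _ (funext fun i => M.eval_congr (ts i) fun x hx => ?_))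
    exact M.ext_congr (ys.name_injective i) fun hxy => h x (Set.mem_iUnion.2 ⟨i, hx, hxy⟩)
  | imp A B ihA ihB =>
    exact imp_congr (ihA fun x hx => h x (Or.inl hx)) (ihB fun x hx => h x (Or.inr hx))
  | and A B ihA ihB =>
    exact and_congr (ihA fun x hx => h x (Or.inl hx)) (ihB fun x hx => h x (Or.inr hx))
  | or A B ihA ihB =>
    exact or_congr (ihA fun x hx => h x (Or.inl hx)) (ihB fun x hx => h x (Or.inr hx))
  | bot => exact Iff.rfl
  | all x A ih => exact forall_congr' fun a => ih (update_congr h a)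
  | ex x A ih => exact exists_congr fun a => ih (update_congr h a)

open scoped Classical in
theorem sat_update_of_notMem_freeVars {A : Formula L V} {x : V} (hx : x ∉ A.freeVars)
    (φ : V → M.carrier 0) (a : M.carrier 0) : M.Sat (Function.update φ x a) A ↔ M.Sat φ A :=
  M.sat_congr A fun _ hz => Function.update_of_ne (ne_of_mem_of_not_mem hz hx) _ _

open scoped Classical in
theorem eval_restrict_update {θ : V → Term L V} {x : V} (h : Avoids θ {x}) (φ : V → M.carrier 0)
    (a : M.carrier 0) :
    (fun z => M.eval (restrict {x} θ z) (Function.update φ x a)) =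
      Function.update (fun z => M.eval (θ z) φ) x a := by
  funext z
  rcases eq_or_ne z x with rfl | hzx
  · rw [restrict, if_pos (Set.mem_singleton z), eval, Function.update_self, Function.update_self]
  rw [Function.update_of_ne hzx, restrict, if_neg (show z ∉ ({x} : Set V) from hzx)]
  refine M.eval_congr _ fun y hy => Function.update_of_ne ?_ _ _
  rintro rfl
  rcases h z with h | h
  · rw [h] at hy
    exact hzx hy.symm
  · exact h _ hy rfl

theorem sat_graft (A : Formula L V) (φ : V → M.carrier 0) {θ : V → Term L V}
    (h : Avoids θ A.vars) : M.Sat φ (A.graft θ) ↔ M.Sat (fun x => M.eval (θ x) φ) A := by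
  induction A generalizing φ θ with
  | atom P ys ts =>
    have hys (i) : Avoids θ (Set.range (ys.name i) ∪ (ts i).vars) :=
      h.mono (Set.subset_iUnion_of_subset i subset_rfl)
    rw [Formula.graft, M.sat_atom, M.sat_atom]
    refine iff_of_eq (congrArg _ (funext fun i => ?_))
    rw [M.eval_graft (ts i) _ (((hys i).mono Set.subset_union_right).restrict _)]
    simp only [M.eval_restrict_ext (ys.name_injective i) ((hys i).mono Set.subset_union_left)]
  | imp A B ihA ihB =>
    exact imp_congr (ihA φ (h.mono Set.subset_union_left)) (ihB φ (h.mono Set.subset_union_right))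
  | and A B ihA ihB =>
    exact and_congr (ihA φ (h.mono Set.subset_union_left)) (ihB φ (h.mono Set.subset_union_right))
  | or A B ihA ihB =>
    exact or_congr (ihA φ (h.mono Set.subset_union_left)) (ihB φ (h.mono Set.subset_union_right))
  | bot => exact Iff.rfl
  | all x A ih =>
    refine forall_congr' fun a => ?_
    rw [ih _ ((h.mono Set.subset_union_right).restrict _),
      M.eval_restrict_update (h.mono Set.subset_union_left)]
  | ex x A ih =>
    refine exists_congr fun a => ?_
    rw [ih _ ((h.mono Set.subset_union_right).restrict _),
      M.eval_restrict_update (h.mono Set.subset_union_left)]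

open scoped Classical in
theorem sat_graft_renameMap (A : Formula L V) (φ : V → M.carrier 0) {x y : V} (h : y ∉ A.vars) :
    M.Sat φ (A.graft (renameMap ![y] ![x])) ↔ M.Sat (Function.update φ x (φ y)) A := by
  rw [M.sat_graft A φ (avoids_renameMap (injective_vec_one x) (by simpa using h))]
  refine M.sat_congr A fun z _ => ?_
  rcases eq_or_ne z x with rfl | hz
  · rw [renameMap_vec_self, Function.update_self, eval]
  · rw [renameMap_vec_of_ne y hz, Function.update_of_ne hz, eval]

open scoped Classical in
theorem sat_update_graft_renameMap (A : Formula L V) (φ : V → M.carrier 0) {x y : V}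
    (h : y ∉ A.vars) (a : M.carrier 0) :
    M.Sat (Function.update φ y a) (A.graft (renameMap ![y] ![x])) ↔
      M.Sat (Function.update φ x a) A := by
  rw [M.sat_graft_renameMap A _ h, Function.update_self]
  rcases eq_or_ne y x with rfl | hyx
  · rw [Function.update_idem]
  · rw [Function.update_comm hyx]
    exact M.sat_update_of_notMem_freeVars (fun hy => h (A.freeVars_subset_vars hy)) _ _

theorem sat_alpha {A A' : Formula L V} (h : A.Alpha A') (φ : V → M.carrier 0) :
    M.Sat φ A ↔ M.Sat φ A' := by
  classical
  induction h generalizing φ with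
  | atom P xs xs' ts ts' ys hy fresh h =>
    rw [M.sat_atom, M.sat_atom]
    refine iff_of_eq (congrArg _ (funext fun i => ?_))
    rw [← M.eval_graft_renameMap (ts i) φ (hy i) (xs.name_injective i) fun j => (fresh i j).1,
      M.eval_alpha (h i),
      M.eval_graft_renameMap (ts' i) φ (hy i) (xs'.name_injective i) fun j => (fresh i j).2]
  | imp _ _ ihA ihB => exact imp_congr (ihA φ) (ihB φ)
  | and _ _ ihA ihB => exact and_congr (ihA φ) (ihB φ)
  | or _ _ ihA ihB => exact or_congr (ihA φ) (ihB φ)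
  | bot => exact Iff.rfl
  | all x x' y A A' fresh _ ih =>
    refine forall_congr' fun a => ?_
    rw [← M.sat_update_graft_renameMap A φ fresh.1 a, ih,
      M.sat_update_graft_renameMap A' φ fresh.2 a]
  | ex x x' y A A' fresh _ ih =>
    refine exists_congr fun a => ?_
    rw [← M.sat_update_graft_renameMap A φ fresh.1 a, ih,
      M.sat_update_graft_renameMap A' φ fresh.2 a]

open scoped Classical in
theorem sat_update_update_graft_renameMap {t : Term L V} {x y z : V} {A : Formula L V}
    (hA : y ∉ A.vars) (ht : y ∉ t.vars) (hx : y ≠ x) (φ : V → M.carrier 0) (a : M.carrier 0) :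
    M.Sat (Function.update (Function.update φ y a) x (M.eval t (Function.update φ y a)))
        (A.graft (renameMap ![y] ![z])) ↔
      M.Sat (Function.update (Function.update φ x (M.eval t φ)) z a) A := by
  have hte : M.eval t (Function.update φ y a) = M.eval t φ := M.eval_congr t fun w hw =>
    Function.update_of_ne (ne_of_mem_of_not_mem (t.freeVars_subset_vars hw) ht) _ _
  rw [hte, Function.update_comm hx, M.sat_update_graft_renameMap A _ hA]

open scoped Classical in
theorem sat_isSubst {t : Term L V} {x : V} {A A' : Formula L V} (h : Formula.IsSubst t x A A')
    (φ : V → M.carrier 0) : M.Sat φ A' ↔ M.Sat (Function.update φ x (M.eval t φ)) A := by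
  induction h generalizing φ with
  | atom P xs ys us us' fresh h =>
    rw [M.sat_atom, M.sat_atom]
    refine iff_of_eq (congrArg _ (funext fun i => ?_))
    rw [M.eval_isSubst (h i), M.eval_update_graft_renameMap t (us i) x φ (ys.name_injective i)
      (xs.name_injective i) (fun j hj => (fresh i j).1 (Set.mem_iUnion.2 ⟨i, Or.inr hj⟩))
      (fun j => (fresh i j).2.1) (fun j => (fresh i j).2.2)]
  | imp _ _ ihA ihB => exact imp_congr (ihA φ) (ihB φ)
  | and _ _ ihA ihB => exact and_congr (ihA φ) (ihB φ)
  | or _ _ ihA ihB => exact or_congr (ihA φ) (ihB φ)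
  | bot => exact Iff.rfl
  | all z y A A' fresh _ ih =>
    refine forall_congr' fun a => ?_
    rw [ih, M.sat_update_update_graft_renameMap (fun h => fresh.1 (Or.inr h)) fresh.2.1 fresh.2.2]
  | ex z y A A' fresh _ ih =>
    refine exists_congr fun a => ?_
    rw [ih, M.sat_update_update_graft_renameMap (fun h => fresh.1 (Or.inr h)) fresh.2.1 fresh.2.2]

/-- The truth of the sequent `Γ ⊢ Δ` under one assignment. -/
def SatSequent (φ : V → M.carrier 0) (Γ Δ : Multiset (Formula L V)) : Prop :=
  (∀ A ∈ Γ, M.Sat φ A) → ∃ B ∈ Δ, M.Sat φ B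

variable {φ : V → M.carrier 0} {Γ Γ' Δ Δ' : Multiset (Formula L V)} {A : Formula L V}

theorem satSequent_cons_left :
    M.SatSequent φ (A ::ₘ Γ) Δ ↔ (M.Sat φ A → M.SatSequent φ Γ Δ) := by
  simp only [SatSequent, Multiset.mem_cons, forall_eq_or_imp, and_imp]

theorem satSequent_cons_right :
    M.SatSequent φ Γ (A ::ₘ Δ) ↔ M.Sat φ A ∨ M.SatSequent φ Γ Δ := by
  simp only [SatSequent, Multiset.mem_cons, exists_eq_or_imp]
  tauto

theorem satSequent_of_rel_alpha (hΓ : Multiset.Rel Formula.Alpha Γ Γ')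
    (hΔ : Multiset.Rel Formula.Alpha Δ Δ') (h : M.SatSequent φ Γ Δ) : M.SatSequent φ Γ' Δ' := by
  intro hsat
  obtain ⟨B, hB, hsatB⟩ := h fun A hA => by
    obtain ⟨A', hA', hAA'⟩ := Multiset.exists_mem_of_rel_of_mem hΓ hA
    exact (M.sat_alpha hAA' φ).2 (hsat A' hA')
  obtain ⟨B', hB', hBB'⟩ := Multiset.exists_mem_of_rel_of_mem hΔ hB
  exact ⟨B', hB', (M.sat_alpha hBB' φ).1 hsatB⟩

open scoped Classical in
theorem satSequent_update {x : V} (hΓ : ∀ B ∈ Γ, x ∉ B.freeVars) (hΔ : ∀ B ∈ Δ, x ∉ B.freeVars)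
    (a : M.carrier 0) : M.SatSequent (Function.update φ x a) Γ Δ ↔ M.SatSequent φ Γ Δ :=
  imp_congr (forall₂_congr fun B hB => M.sat_update_of_notMem_freeVars (hΓ B hB) φ a)
    (exists_congr fun B => and_congr_right fun hB =>
      M.sat_update_of_notMem_freeVars (hΔ B hB) φ a)

end BindingModel

open BindingModel in
theorem Provable.sound (M : BindingModel.{u, v} L) {Γ Δ : Multiset (Formula L V)}
    (h : Provable Γ Δ) (φ : V → M.carrier 0) : M.SatSequent φ Γ Δ := by
  classical
  induction h generalizing φ with
  | alpha hΓ hΔ _ ih => exact M.satSequent_of_rel_alpha hΓ hΔ (ih φ)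
  | ax A => exact fun h => ⟨A, Multiset.mem_singleton_self A, h A (Multiset.mem_singleton_self A)⟩
  | allLeft t hs _ ih =>
    rw [satSequent_cons_left]
    exact fun hall => M.satSequent_cons_left.1 (ih φ) ((M.sat_isSubst hs φ).2 (hall _))
  | allRight hΓ hΔ _ ih =>
    rw [satSequent_cons_right, or_iff_not_imp_right]
    refine fun hsat a => (M.satSequent_cons_right.1 (ih (Function.update φ _ a))).resolve_right ?_
    rwa [M.satSequent_update hΓ hΔ]
  | exLeft hΓ hΔ _ ih =>
    rw [satSequent_cons_left]
    rintro ⟨a, ha⟩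
    exact (M.satSequent_update hΓ hΔ a).1 (M.satSequent_cons_left.1 (ih _) ha)
  | exRight t hs _ ih =>
    rw [satSequent_cons_right]
    exact (M.satSequent_cons_right.1 (ih φ)).imp_left fun h => ⟨_, (M.sat_isSubst hs φ).1 h⟩
  | _ =>
    simp only [satSequent_cons_left, satSequent_cons_right, Sat] at *
    grind

end Soundness

/-! ### De Bruijn terms -/

/-- Terms with de Bruijn indices below `n` for the bound variables and names for the free ones.
They represent terms up to `α`-equivalence and are the carriers of the term model. -/
inductive DeBruijn (L : Language.{u}) (V : Type w) : ℕ → Type (max u w)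
  | free {n : ℕ} (x : V) : DeBruijn L V n
  | bound {n : ℕ} (i : Fin n) : DeBruijn L V n
  | app {n : ℕ} (f : L.Func)
      (ts : (i : Fin (L.funcArity f).length) → DeBruijn L V ((L.funcArity f).get i + n)) :
      DeBruijn L V n

namespace DeBruijn

variable {L : Language.{u}} {V : Type w}

/-- The extension of a map of indices under `k` binders, whose indices are the first `k`. -/
def liftIndex {n p : ℕ} (k : ℕ) (r : Fin n → Fin p) : Fin (k + n) → Fin (k + p) :=
  Fin.append (Fin.castAdd p) fun j => Fin.natAdd k (r j)

/-- Renaming of the indices. It is defined before substitution because substitution under a binder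
has to shift the indices of the terms that are substituted. -/
def rename : {n : ℕ} → DeBruijn L V n → {p : ℕ} → (Fin n → Fin p) → DeBruijn L V p
  | _, free x, _, _ => free x
  | _, bound i, _, r => bound (r i)
  | _, app f ts, _, r => app f fun i => (ts i).rename (liftIndex _ r)

/-- The extension of a substitution under `k` binders, whose indices are the first `k`. -/
def liftSubst {n p : ℕ} (k : ℕ) (σ : Fin n → DeBruijn L V p) : Fin (k + n) → DeBruijn L V (k + p) :=
  Fin.append (fun j => bound (Fin.castAdd p j)) fun j => (σ j).rename (Fin.natAdd k)

/-- Parallel substitution for the indices. -/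
def subst : {n : ℕ} → DeBruijn L V n → {p : ℕ} → (Fin n → DeBruijn L V p) → DeBruijn L V p
  | _, free x, _, _ => free x
  | _, bound i, _, σ => σ i
  | _, app f ts, _, σ => app f fun i => (ts i).subst (liftSubst _ σ)

theorem liftSubst_bound_comp {n p : ℕ} (k : ℕ) (r : Fin n → Fin p) :
    liftSubst (L := L) (V := V) k (fun j => bound (r j)) = fun j => bound (liftIndex k r j) := by
  funext j
  induction j using Fin.addCases <;> simp [liftSubst, liftIndex, rename]

theorem liftSubst_bound {n : ℕ} (k : ℕ) :
    liftSubst (L := L) (V := V) (n := n) k bound = bound := by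
  funext j
  induction j using Fin.addCases <;> simp [liftSubst, rename]

theorem liftSubst_liftIndex {n p q : ℕ} (k : ℕ) (r : Fin n → Fin p) (τ : Fin p → DeBruijn L V q) :
    (fun j => liftSubst k τ (liftIndex k r j)) = liftSubst k fun j => τ (r j) := by
  funext j
  induction j using Fin.addCases <;> simp [liftSubst, liftIndex]

theorem rename_eq_subst {n p : ℕ} (t : DeBruijn L V n) (r : Fin n → Fin p) :
    t.rename r = t.subst fun j => bound (r j) := by
  induction t generalizing p with
  | free x => rfl
  | bound i => rfl
  | app f ts ih => simp only [rename, subst, liftSubst_bound_comp, ih]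

theorem subst_rename {n p q : ℕ} (t : DeBruijn L V n) (r : Fin n → Fin p)
    (τ : Fin p → DeBruijn L V q) : (t.rename r).subst τ = t.subst fun j => τ (r j) := by
  induction t generalizing p q with
  | free x => rfl
  | bound i => rfl
  | app f ts ih => simp only [rename, subst, ih, liftSubst_liftIndex]

theorem rename_rename {n p q : ℕ} (t : DeBruijn L V n) (r : Fin n → Fin p) (s : Fin p → Fin q) :
    (t.rename r).rename s = t.rename fun j => s (r j) := by
  rw [rename_eq_subst _ s, subst_rename, ← rename_eq_subst]

theorem liftSubst_rename {n p q : ℕ} (k : ℕ) (σ : Fin n → DeBruijn L V p) (s : Fin p → Fin q) :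
    (fun j => (liftSubst k σ j).rename (liftIndex k s)) =
      liftSubst k fun j => (σ j).rename s := by
  funext j
  induction j using Fin.addCases <;> simp [liftSubst, liftIndex, rename, rename_rename]

theorem rename_subst {n p q : ℕ} (t : DeBruijn L V n) (σ : Fin n → DeBruijn L V p)
    (s : Fin p → Fin q) : (t.subst σ).rename s = t.subst fun j => (σ j).rename s := by
  induction t generalizing p q with
  | free x => rfl
  | bound i => rfl
  | app f ts ih => simp only [rename, subst, ih, liftSubst_rename]

theorem liftSubst_subst {n p q : ℕ} (k : ℕ) (σ : Fin n → DeBruijn L V p)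
    (τ : Fin p → DeBruijn L V q) :
    (fun j => (liftSubst k σ j).subst (liftSubst k τ)) = liftSubst k fun j => (σ j).subst τ := by
  funext j
  induction j using Fin.addCases <;> simp [liftSubst, subst, subst_rename, rename_subst]

theorem subst_subst {n p q : ℕ} (t : DeBruijn L V n) (σ : Fin n → DeBruijn L V p)
    (τ : Fin p → DeBruijn L V q) : (t.subst σ).subst τ = t.subst fun j => (σ j).subst τ := by
  induction t generalizing p q with
  | free x => rfl
  | bound i => rfl
  | app f ts ih => simp only [subst, ih, liftSubst_subst]

theorem subst_bound {n : ℕ} (t : DeBruijn L V n) : t.subst bound = t := by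
  induction t with
  | free x => rfl
  | bound i => rfl
  | app f ts ih => simp only [subst, liftSubst_bound, ih]

/-- The names that occur in a de Bruijn term. -/
def names : {n : ℕ} → DeBruijn L V n → Set V
  | _, free x => {x}
  | _, bound _ => ∅
  | _, app _ ts => ⋃ i, (ts i).names

theorem finite_names {n : ℕ} (t : DeBruijn L V n) : t.names.Finite := by
  induction t with
  | free x => exact Set.finite_singleton x
  | bound _ => exact Set.finite_empty
  | app f ts ih => exact Set.finite_iUnion ih

/-- A de Bruijn term that is a name or an index, not an application: the value of every variable
in the environments that translate named terms to de Bruijn terms. -/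
def IsAtom : {n : ℕ} → DeBruijn L V n → Prop
  | _, free _ => True
  | _, bound _ => True
  | _, app _ _ => False

theorem IsAtom.rename {n p : ℕ} {t : DeBruijn L V n} (h : t.IsAtom) (r : Fin n → Fin p) :
    (t.rename r).IsAtom := by
  cases t with
  | free x => trivial
  | bound i => trivial
  | app f ts => exact h

theorem IsAtom.ne_app {n : ℕ} {t : DeBruijn L V n} (h : t.IsAtom) (f : L.Func)
    (ts : (i : Fin (L.funcArity f).length) → DeBruijn L V ((L.funcArity f).get i + n)) :
    t ≠ app f ts := by
  rintro rfl
  exact h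

end DeBruijn

/-- The binding model whose elements of level `n` are the de Bruijn terms with `n` indices; its
predicates play no role and are all true. -/
abbrev deBruijnModel (L : Language.{u}) (V : Type w) : BindingModel.{u, max u w} L where
  carrier := DeBruijn L V
  proj := .bound
  comp a b := a.subst b
  proj_comp _ _ := rfl
  comp_proj := DeBruijn.subst_bound
  comp_assoc a b c := a.subst_subst b c
  func f _ ts := .app f ts
  func_comp f p q a b := by
    change DeBruijn.app f _ = DeBruijn.app f _
    simp only [IntensionalStructure.lift, ← DeBruijn.rename_eq_subst]
    rfl
  pred _ _ := True

namespace BindingModel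

variable {L : Language.{u}} {V : Type w} (M : BindingModel.{u, v} L)

/-- The model `M` with another interpretation of the predicate symbols. -/
abbrev withPred (I : (P : L.Pred) →
    ((i : Fin (L.predArity P).length) → M.carrier ((L.predArity P).get i)) → Prop) :
    BindingModel.{u, v} L :=
  { M with pred := I }

theorem eval_withPred (I) (t : Term L V) {p : ℕ} (ρ : V → M.carrier p) :
    (M.withPred I).eval t ρ = M.eval t ρ := by
  induction t generalizing p with
  | var x => rfl
  | app f ys ts ih => exact congrArg (M.func f p) (funext fun i => ih i _)

end BindingModel

/-! ### Fresh variables and induction up to renaming -/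

section Freshness

variable {L : Language.{u}} {V : Type w}

theorem Term.finite_vars (t : Term L V) : t.vars.Finite := by
  induction t with
  | var x => exact Set.finite_singleton x
  | app f xs ts ih => exact Set.finite_iUnion fun i => (Set.finite_range _).union (ih i)

theorem Formula.finite_vars (A : Formula L V) : A.vars.Finite := by
  induction A with
  | atom P xs ts => exact Set.finite_iUnion fun i => (Set.finite_range _).union (ts i).finite_vars
  | imp A B ihA ihB => exact ihA.union ihB
  | and A B ihA ihB => exact ihA.union ihB
  | or A B ihA ihB => exact ihA.union ihB
  | bot => exact Set.finite_empty
  | all x A ih => exact (Set.finite_singleton x).union ih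
  | ex x A ih => exact (Set.finite_singleton x).union ih

theorem exists_injective_avoiding [Infinite V] {S : Set V} (hS : S.Finite) (α : Type*)
    [Finite α] : ∃ f : α → V, Function.Injective f ∧ ∀ a, f a ∉ S := by
  have : Infinite (Sᶜ : Set V) := hS.infinite_compl.to_subtype
  let f : α ↪ (Sᶜ : Set V) :=
    ((Finite.equivFin α).toEmbedding.trans Fin.valEmbedding).trans (Infinite.natEmbedding _)
  exact ⟨fun a => f a, Subtype.val_injective.comp f.injective, fun a => (f a).2⟩

theorem Binders.exists_avoiding [Infinite V] {S : Set V} (hS : S.Finite) (k : List ℕ) :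
    ∃ ys : Binders k V, ∀ i j, ys.name i j ∉ S := by
  obtain ⟨f, hf, hfS⟩ := exists_injective_avoiding hS ((i : Fin k.length) × Fin (k.get i))
  exact ⟨⟨fun i j => f ⟨i, j⟩, hf⟩, fun i j => hfS _⟩

/-- The height of a term, which is invariant under the renaming of variables. -/
def Term.height : Term L V → ℕ
  | .var _ => 0
  | .app _ _ ts => (Finset.univ.sup fun i => (ts i).height) + 1

theorem Term.height_lt (f : L.Func) (xs : Binders (L.funcArity f) V)
    (ts : Fin (L.funcArity f).length → Term L V) (i : Fin (L.funcArity f).length) :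
    (ts i).height < (Term.app f xs ts).height :=
  Nat.lt_succ_of_le (Finset.le_sup (f := fun i => (ts i).height) (Finset.mem_univ i))

theorem Term.height_graft (t : Term L V) {θ : V → Term L V} (h : ∀ x, (θ x).height = 0) :
    (t.graft θ).height = t.height := by
  induction t generalizing θ with
  | var x => exact h x
  | app f xs ts ih =>
    have hr (i x) : (restrict (Set.range (xs.name i)) θ x).height = 0 := by
      rw [restrict]
      split_ifs
      exacts [rfl, h x]
    simp only [Term.graft, Term.height, ih _ (hr _)]

theorem height_renameMap {k : ℕ} (ys xs : Fin k → V) (x : V) :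
    (renameMap ys xs x : Term L V).height = 0 := by
  classical
  rw [renameMap, Function.extend_def]
  split_ifs <;> rfl

theorem Term.rename_induction {P : Term L V → Prop} (var : ∀ x, P (.var x))
    (app : ∀ f xs ts, (∀ i (ys : Fin ((L.funcArity f).get i) → V),
      P ((ts i).graft (renameMap ys (xs.name i)))) → P (.app f xs ts)) : ∀ t : Term L V, P t
  | .var x => var x
  | .app f xs ts => app f xs ts fun i ys => Term.rename_induction var app _
  termination_by t => t.height
  decreasing_by
    rw [Term.height_graft _ (height_renameMap _ _)]
    exact Term.height_lt f xs ts i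

theorem Term.exists_isSubst [Infinite V] (t : Term L V) (x : V) (u : Term L V) :
    ∃ u', Term.IsSubst t x u u' := by
  induction u using Term.rename_induction with
  | var z =>
    rcases eq_or_ne z x with rfl | h
    · exact ⟨_, .var_self⟩
    · exact ⟨_, .var_other z h⟩
  | app f xs us ih =>
    obtain ⟨ys, hys⟩ := Binders.exists_avoiding ((Term.app f xs us).finite_vars.union
      (t.finite_vars.union (Set.finite_singleton x))) (L.funcArity f)
    simp only [Set.mem_union, Set.mem_singleton_iff, not_or] at hys
    choose us' hus' using fun i => ih i (ys.name i)
    exact ⟨_, .app f xs ys us us' hys hus'⟩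

/-- The number of connectives and quantifiers of a proposition. -/
def Formula.size : Formula L V → ℕ
  | .atom _ _ _ => 0
  | .imp A B => A.size + B.size + 1
  | .and A B => A.size + B.size + 1
  | .or A B => A.size + B.size + 1
  | .bot => 0
  | .all _ A => A.size + 1
  | .ex _ A => A.size + 1

theorem Formula.size_graft (A : Formula L V) (θ : V → Term L V) : (A.graft θ).size = A.size := by
  induction A generalizing θ <;> simp only [Formula.graft, Formula.size, *]

theorem Formula.IsSubst.size_eq {t : Term L V} {x : V} {A A' : Formula L V}
    (h : Formula.IsSubst t x A A') : A'.size = A.size := by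
  induction h <;> simp_all only [Formula.size, Formula.size_graft]

theorem Formula.size_induction {P : Formula L V → Prop} (atom : ∀ R xs ts, P (.atom R xs ts))
    (imp : ∀ A B, P A → P B → P (.imp A B)) (and : ∀ A B, P A → P B → P (.and A B))
    (or : ∀ A B, P A → P B → P (.or A B)) (bot : P .bot)
    (all : ∀ x A, (∀ A' : Formula L V, A'.size = A.size → P A') → P (.all x A))
    (ex : ∀ x A, (∀ A' : Formula L V, A'.size = A.size → P A') → P (.ex x A)) :
    ∀ A : Formula L V, P A
  | .atom R xs ts => atom R xs ts
  | .imp A B => imp A B (Formula.size_induction atom imp and or bot all ex A)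
      (Formula.size_induction atom imp and or bot all ex B)
  | .and A B => and A B (Formula.size_induction atom imp and or bot all ex A)
      (Formula.size_induction atom imp and or bot all ex B)
  | .or A B => or A B (Formula.size_induction atom imp and or bot all ex A)
      (Formula.size_induction atom imp and or bot all ex B)
  | .bot => bot
  | .all x A => all x A fun A' _ => Formula.size_induction atom imp and or bot all ex A'
  | .ex x A => ex x A fun A' _ => Formula.size_induction atom imp and or bot all ex A'
  termination_by A => A.size
  decreasing_by all_goals simp only [Formula.size]; omega

theorem Formula.exists_isSubst [Infinite V] (t : Term L V) (x : V) (A : Formula L V) :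
    ∃ A', Formula.IsSubst t x A A' := by
  have finite_union (B : Formula L V) : (B.vars ∪ (t.vars ∪ {x})).Finite :=
    B.finite_vars.union (t.finite_vars.union (Set.finite_singleton x))
  have exists_fresh (B : Formula L V) : ∃ y, y ∉ B.vars ∧ y ∉ t.vars ∧ y ≠ x := by
    simpa only [Set.mem_union, Set.mem_singleton_iff, not_or] using (finite_union B).exists_notMem
  induction A using Formula.size_induction with
  | atom P xs us =>
    obtain ⟨ys, hys⟩ := Binders.exists_avoiding (finite_union (.atom P xs us)) (L.predArity P)
    simp only [Set.mem_union, Set.mem_singleton_iff, not_or] at hys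
    choose us' hus' using fun i =>
      Term.exists_isSubst t x ((us i).graft (renameMap (ys.name i) (xs.name i)))
    exact ⟨_, .atom P xs ys us us' hys hus'⟩
  | imp A B ihA ihB => exact ⟨_, .imp ihA.choose_spec ihB.choose_spec⟩
  | and A B ihA ihB => exact ⟨_, .and ihA.choose_spec ihB.choose_spec⟩
  | or A B ihA ihB => exact ⟨_, .or ihA.choose_spec ihB.choose_spec⟩
  | bot => exact ⟨_, .bot⟩
  | all z A ih =>
    obtain ⟨y, hy⟩ := exists_fresh (.all z A)
    exact ⟨_, .all z y A _ hy (ih _ (A.size_graft _)).choose_spec⟩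
  | ex z A ih =>
    obtain ⟨y, hy⟩ := exists_fresh (.ex z A)
    exact ⟨_, .ex z y A _ hy (ih _ (A.size_graft _)).choose_spec⟩

end Freshness

/-! ### Adequacy of de Bruijn terms -/

section Adequacy

theorem injective_extend {α β γ : Type*} {f : α → β} {g : α → γ} {e : β → γ}
    (hf : Function.Injective f) (hg : Function.Injective g) (he : Function.Injective e)
    (hge : ∀ a b, g a ≠ e b) : Function.Injective (Function.extend f g e) := by
  intro x y h
  by_cases hx : ∃ a, f a = x <;> by_cases hy : ∃ a, f a = y
  · obtain ⟨a, rfl⟩ := hx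
    obtain ⟨b, rfl⟩ := hy
    rw [hf.extend_apply, hf.extend_apply] at h
    rw [hg h]
  · obtain ⟨a, rfl⟩ := hx
    rw [hf.extend_apply, Function.extend_apply' _ _ _ hy] at h
    exact absurd h (hge a y)
  · obtain ⟨b, rfl⟩ := hy
    rw [hf.extend_apply, Function.extend_apply' _ _ _ hx] at h
    exact absurd h.symm (hge b x)
  · rw [Function.extend_apply' _ _ _ hx, Function.extend_apply' _ _ _ hy] at h
    exact he h

variable {L : Language.{u}} {V : Type w}

namespace DeBruijn

/-- The environments under which the value of a named term is its translation to a de Bruijn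
term: distinct variables are sent to distinct names and indices. -/
structure IsNaming {p : ℕ} (ρ : V → DeBruijn L V p) : Prop where
  injective : Function.Injective ρ
  isAtom : ∀ x, (ρ x).IsAtom

theorem isNaming_free : IsNaming (free : V → DeBruijn L V 0) :=
  ⟨fun _ _ => free.inj, fun _ => trivial⟩

theorem rename_natAdd_injective {p : ℕ} (k : ℕ) :
    Function.Injective fun t : DeBruijn L V p => t.rename (Fin.natAdd k) := by
  intro t t' h
  -- The indices below `k` do not occur, so whatever they are replaced by is irrelevant.
  have subst_eq (s : DeBruijn L V p) :
      (s.rename (Fin.natAdd k)).subst (Fin.append (fun _ => t) bound) = s := by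
    simp only [subst_rename, Fin.append_right, subst_bound]
  rw [← subst_eq t, ← subst_eq t']
  exact congrArg (fun s : DeBruijn L V (k + p) => s.subst _) h

theorem rename_natAdd_ne_bound_castAdd {p k : ℕ} (t : DeBruijn L V p) (j : Fin k) :
    t.rename (Fin.natAdd k) ≠ bound (Fin.castAdd p j) := by
  cases t with
  | free x => nofun
  | bound i =>
    intro h
    have hval : k + (i : ℕ) = j := congrArg Fin.val (bound.inj h)
    omega
  | app f ts => nofun

theorem ext_eq_rename {p k : ℕ} (ρ : V → DeBruijn L V p) (ys : Fin k → V) :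
    (deBruijnModel L V).ext ρ ys = Function.extend ys (fun j => bound (Fin.castAdd p j.rev))
      fun x => (ρ x).rename (Fin.natAdd k) := by
  simp only [BindingModel.ext, rename_eq_subst]

theorem ext_of_notMem {p k : ℕ} (ρ : V → DeBruijn L V p) {ys : Fin k → V} {x : V}
    (hx : x ∉ Set.range ys) : (deBruijnModel L V).ext ρ ys x = (ρ x).rename (Fin.natAdd k) := by
  rw [rename_eq_subst]
  exact (deBruijnModel L V).ext_of_notMem ρ hx

theorem IsNaming.ext {p k : ℕ} {ρ : V → DeBruijn L V p} (h : IsNaming ρ) {ys : Fin k → V}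
    (hy : Function.Injective ys) : IsNaming ((deBruijnModel L V).ext ρ ys) := by
  constructor
  · rw [ext_eq_rename]
    refine injective_extend hy ?_ ((rename_natAdd_injective k).comp h.injective) fun j x =>
      (rename_natAdd_ne_bound_castAdd (ρ x) j.rev).symm
    exact fun i j hij => Fin.rev_injective (Fin.castAdd_injective k p (bound.inj hij))
  · intro x
    by_cases hx : x ∈ Set.range ys
    · obtain ⟨j, rfl⟩ := hx
      rw [(deBruijnModel L V).ext_name ρ hy]
      trivial
    · rw [ext_of_notMem ρ hx]
      exact (h.isAtom x).rename _

end DeBruijn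

theorem BindingModel.exists_common_renaming [Infinite V] (M : BindingModel.{u, v} L) {p k : ℕ}
    {ρ : V → M.carrier p} {xs xs' : Fin k → V} (hx : Function.Injective xs)
    (hx' : Function.Injective xs') {t t' : Term L V}
    (h : M.eval t (M.ext ρ xs) = M.eval t' (M.ext ρ xs')) :
    ∃ ys : Fin k → V, Function.Injective ys ∧ (∀ j, ys j ∉ t.vars ∧ ys j ∉ t'.vars) ∧
      M.eval (t.graft (renameMap ys xs)) (M.ext ρ ys) =
        M.eval (t'.graft (renameMap ys xs')) (M.ext ρ ys) := by
  obtain ⟨ys, hy, hys⟩ :=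
    exists_injective_avoiding (t.finite_vars.union t'.finite_vars) (Fin k)
  simp only [Set.mem_union, not_or] at hys
  refine ⟨ys, hy, hys, ?_⟩
  rw [M.eval_graft_renameMap t ρ hy hx fun j => (hys j).1,
    M.eval_graft_renameMap t' ρ hy hx' fun j => (hys j).2, h]

open DeBruijn

theorem Term.alpha_of_eval_eq [Infinite V] {t t' : Term L V} {p : ℕ} {ρ : V → DeBruijn L V p}
    (hρ : IsNaming ρ) (h : (deBruijnModel L V).eval t ρ = (deBruijnModel L V).eval t' ρ) :
    t.Alpha t' := by
  induction t using Term.rename_induction generalizing t' p ρ with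
  | var x =>
    cases t' with
    | var x' =>
      obtain rfl : x = x' := hρ.injective h
      exact .var x
    | app f xs ts => exact absurd h ((hρ.isAtom x).ne_app f _)
  | app f xs ts ih =>
    cases t' with
    | var x => exact absurd h.symm ((hρ.isAtom x).ne_app f _)
    | app f' xs' ts' =>
      obtain ⟨rfl, hts⟩ := DeBruijn.app.inj h
      choose ys hy fresh hys using fun i => (deBruijnModel L V).exists_common_renaming
        (xs.name_injective i) (xs'.name_injective i) (congrFun (eq_of_heq hts) i)
      exact .app f xs xs' ts ts' ys hy fresh fun i => ih i (ys i) (hρ.ext (hy i)) (hys i)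

theorem Formula.alpha_atom_of_eval_eq [Infinite V] {P : L.Pred} {xs xs' : Binders (L.predArity P) V}
    {ts ts' : Fin (L.predArity P).length → Term L V}
    (h : ∀ i, (deBruijnModel L V).eval (ts i) ((deBruijnModel L V).ext (p := 0) free (xs.name i)) =
      (deBruijnModel L V).eval (ts' i) ((deBruijnModel L V).ext (p := 0) free (xs'.name i))) :
    (Formula.atom P xs ts).Alpha (.atom P xs' ts') := by
  choose ys hy fresh hys using fun i => (deBruijnModel L V).exists_common_renaming
    (xs.name_injective i) (xs'.name_injective i) (h i)
  exact .atom P xs xs' ts ts' ys hy fresh fun i =>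
    Term.alpha_of_eval_eq (isNaming_free.ext (hy i)) (hys i)

theorem Formula.Alpha.refl [Infinite V] (A : Formula L V) : A.Alpha A := by
  induction A using Formula.size_induction with
  | atom P xs ts => exact Formula.alpha_atom_of_eval_eq fun _ => rfl
  | imp A B ihA ihB => exact .imp ihA ihB
  | and A B ihA ihB => exact .and ihA ihB
  | or A B ihA ihB => exact .or ihA ihB
  | bot => exact .bot
  | all x A ih =>
    obtain ⟨y, hy⟩ := A.finite_vars.exists_notMem
    exact .all x x y A A ⟨hy, hy⟩ (ih _ (A.size_graft _))
  | ex x A ih =>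
    obtain ⟨y, hy⟩ := A.finite_vars.exists_notMem
    exact .ex x x y A A ⟨hy, hy⟩ (ih _ (A.size_graft _))

theorem DeBruijn.exists_eval_eq [Infinite V] {p : ℕ} (d : DeBruijn L V p)
    {ρ : V → DeBruijn L V p} (hbound : ∀ i, ∃ x, ρ x = bound i)
    (hfree : ∀ z ∈ d.names, ∃ x, ρ x = free z) :
    ∃ t : Term L V, (deBruijnModel L V).eval t ρ = d := by
  induction d with
  | free z =>
    obtain ⟨x, hx⟩ := hfree z rfl
    exact ⟨.var x, hx⟩
  | bound i =>
    obtain ⟨x, hx⟩ := hbound i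
    exact ⟨.var x, hx⟩
  | app f ts ih =>
    choose b hb using hbound
    choose! g hg using hfree
    obtain ⟨ys, hys⟩ := Binders.exists_avoiding
      ((Set.finite_range b).union ((DeBruijn.app f ts).finite_names.image g)) (L.funcArity f)
    have ext_of_mem {i x} (hx : x ∈ Set.range b ∪ g '' (DeBruijn.app f ts).names) :
        (deBruijnModel L V).ext ρ (ys.name i) x = (ρ x).rename (Fin.natAdd _) :=
      ext_of_notMem ρ fun ⟨j, hj⟩ => hys i j (hj ▸ hx)
    have exists_arg (i) : ∃ t : Term L V,
        (deBruijnModel L V).eval t ((deBruijnModel L V).ext ρ (ys.name i)) = ts i := by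
      refine ih i (fun l => ?_) fun z hz => ?_
      · induction l using Fin.addCases with
        | left l =>
          refine ⟨ys.name i l.rev, ?_⟩
          rw [(deBruijnModel L V).ext_name _ (ys.name_injective i), Fin.rev_rev]
        | right l =>
          exact ⟨b l, by rw [ext_of_mem (Or.inl ⟨l, rfl⟩), hb, DeBruijn.rename]⟩
      · have hz : z ∈ (DeBruijn.app f ts).names := Set.mem_iUnion.2 ⟨i, hz⟩
        exact ⟨g z, by rw [ext_of_mem (Or.inr ⟨z, hz, rfl⟩), hg z hz, DeBruijn.rename]⟩
    choose us hus using exists_arg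
    exact ⟨.app f ys us, congrArg (DeBruijn.app f) (funext hus)⟩

/-- The map `θ` sends the variables in `S` to variables, in such a way that following it by `θ'`
amounts to `θ''`; a variable that is moved leaves `S`. This is what the composition of two
graftings needs in an expression all of whose variables, bound ones included, are in `S`. -/
def Factors (θ θ' θ'' : V → Term L V) (S : Set V) : Prop :=
  ∀ z ∈ S, ∃ y, θ z = .var y ∧ θ' y = θ'' z ∧ (y = z ∨ y ∉ S)

theorem Factors.mono {θ θ' θ'' : V → Term L V} {S T : Set V} (h : Factors θ θ' θ'' T)
    (hS : S ⊆ T) : Factors θ θ' θ'' S := fun z hz => by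
  obtain ⟨y, hy, hy', hyS⟩ := h z (hS hz)
  exact ⟨y, hy, hy', hyS.imp_right fun h hy => h (hS hy)⟩

theorem Factors.restrict {θ θ' θ'' : V → Term L V} {S R : Set V} (h : Factors θ θ' θ'' S)
    (hR : R ⊆ S) : Factors (restrict R θ) (restrict R θ') (restrict R θ'') S := by
  intro z hz
  by_cases hzR : z ∈ R
  · exact ⟨z, if_pos hzR, by simp [BindingLogic.restrict, hzR], Or.inl rfl⟩
  · obtain ⟨y, hy, hy', hyS⟩ := h z hz
    have hyR : y ∉ R := by
      rcases hyS with rfl | hyS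
      · exact hzR
      · exact fun hyR => hyS (hR hyR)
    exact ⟨y, by simpa only [BindingLogic.restrict, if_neg hzR],
      by simpa only [BindingLogic.restrict, if_neg hzR, if_neg hyR], hyS⟩

theorem Term.graft_graft (t : Term L V) {θ θ' θ'' : V → Term L V} (h : Factors θ θ' θ'' t.vars) :
    (t.graft θ).graft θ' = t.graft θ'' := by
  induction t generalizing θ θ' θ'' with
  | var x =>
    obtain ⟨y, hy, hy', -⟩ := h x rfl
    simp only [Term.graft, hy, hy']
  | app f xs ts ih =>
    simp only [Term.graft]
    congr 1
    funext i
    exact ih i ((h.restrict fun x hx => Set.mem_iUnion.2 ⟨i, Or.inl hx⟩).mono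
      fun x hx => Set.mem_iUnion.2 ⟨i, Or.inr hx⟩)

theorem Formula.graft_graft (A : Formula L V) {θ θ' θ'' : V → Term L V}
    (h : Factors θ θ' θ'' A.vars) : (A.graft θ).graft θ' = A.graft θ'' := by
  induction A generalizing θ θ' θ'' with
  | atom P xs ts =>
    simp only [Formula.graft]
    congr 1
    funext i
    exact (ts i).graft_graft ((h.restrict fun x hx => Set.mem_iUnion.2 ⟨i, Or.inl hx⟩).mono
      fun x hx => Set.mem_iUnion.2 ⟨i, Or.inr hx⟩)
  | imp A B ihA ihB =>
    exact congrArg₂ Formula.imp (ihA (h.mono Set.subset_union_left))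
      (ihB (h.mono Set.subset_union_right))
  | and A B ihA ihB =>
    exact congrArg₂ Formula.and (ihA (h.mono Set.subset_union_left))
      (ihB (h.mono Set.subset_union_right))
  | or A B ihA ihB =>
    exact congrArg₂ Formula.or (ihA (h.mono Set.subset_union_left))
      (ihB (h.mono Set.subset_union_right))
  | bot => rfl
  | all x A ih =>
    exact congrArg (Formula.all x)
      (ih ((h.restrict Set.subset_union_left).mono Set.subset_union_right))
  | ex x A ih =>
    exact congrArg (Formula.ex x)
      (ih ((h.restrict Set.subset_union_left).mono Set.subset_union_right))

theorem Formula.graft_renameMap_renameMap (A : Formula L V) {c : V} (x y : V) (hc : c ∉ A.vars) :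
    (A.graft (renameMap ![c] ![x])).graft (renameMap ![y] ![c]) =
      A.graft (renameMap ![y] ![x]) := by
  refine A.graft_graft fun z hz => ?_
  rcases eq_or_ne z x with rfl | hzx
  · exact ⟨c, renameMap_vec_self c z, by simp only [renameMap_vec_self], Or.inr hc⟩
  · have hzc : z ≠ c := fun h => hc (h ▸ hz)
    exact ⟨z, renameMap_vec_of_ne c hzx,
      by rw [renameMap_vec_of_ne y hzc, renameMap_vec_of_ne y hzx], Or.inl rfl⟩

variable [Infinite V] (A : Formula L V) {c : V} (x : V)

theorem Formula.alpha_all (hc : c ∉ A.vars) :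
    (Formula.all c (A.graft (renameMap ![c] ![x]))).Alpha (.all x A) := by
  obtain ⟨y, hy⟩ :=
    ((A.graft (renameMap ![c] ![x])).finite_vars.union A.finite_vars).exists_notMem
  refine .all c x y _ A (by simpa only [Set.mem_union, not_or] using hy) ?_
  rw [A.graft_renameMap_renameMap x y hc]
  exact .refl _

theorem Formula.alpha_ex (hc : c ∉ A.vars) :
    (Formula.ex c (A.graft (renameMap ![c] ![x]))).Alpha (.ex x A) := by
  obtain ⟨y, hy⟩ :=
    ((A.graft (renameMap ![c] ![x])).finite_vars.union A.finite_vars).exists_notMem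
  refine .ex c x y _ A (by simpa only [Set.mem_union, not_or] using hy) ?_
  rw [A.graft_renameMap_renameMap x y hc]
  exact .refl _

end Adequacy

/-! ### Countability of the syntax -/

section Countability

theorem countable_of_rank {α : Type*} (r : α → ℕ)
    (h : ∀ n, {a | r a < n}.Countable → {a | r a = n}.Countable) : Countable α := by
  have countable_lt (n : ℕ) : {a | r a < n}.Countable := by
    induction n with
    | zero => simp only [not_lt_zero, Set.ofPred_false, Set.countable_empty]
    | succ n ih => simpa only [Nat.lt_succ_iff_lt_or_eq, Set.ofPred_or] using ih.union (h n ih)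
  exact Set.countable_univ_iff.1 <| (Set.countable_iUnion countable_lt).mono fun a _ =>
    Set.mem_iUnion.2 ⟨r a + 1, Nat.lt_succ_self _⟩

variable {L : Language.{u}} {V : Type w}

instance Binders.countable [Countable V] (k : List ℕ) : Countable (Binders k V) :=
  Function.Injective.countable (f := Binders.name) fun ⟨_, _⟩ ⟨_, _⟩ h => by
    cases h
    rfl

instance Term.countable [Countable L.Func] [Countable V] : Countable (Term L V) := by
  refine countable_of_rank Term.height fun n hn => ?_
  have := hn.to_subtype
  refine ((Set.countable_range (Term.var : V → Term L V)).union (Set.countable_range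
    fun a : (f : L.Func) × Binders (L.funcArity f) V ×
        (Fin (L.funcArity f).length → {t : Term L V | t.height < n}) =>
      Term.app a.1 a.2.1 fun i => a.2.2 i)).mono ?_
  rintro (x | ⟨f, xs, ts⟩) ht
  · exact Or.inl ⟨x, rfl⟩
  · exact Or.inr ⟨⟨f, xs, fun i => ⟨ts i, (Term.height_lt f xs ts i).trans_eq ht⟩⟩, rfl⟩

instance Formula.countable [Countable L.Func] [Countable L.Pred] [Countable V] :
    Countable (Formula L V) := by
  refine countable_of_rank Formula.size fun n hn => ?_
  have hV := Set.countable_univ (α := V)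
  refine (((((((Set.countable_range
    fun a : (P : L.Pred) × Binders (L.predArity P) V × (Fin (L.predArity P).length → Term L V) =>
      Formula.atom a.1 a.2.1 a.2.2).union (hn.image2 hn .imp)).union (hn.image2 hn .and)).union
    (hn.image2 hn .or)).union (Set.countable_singleton .bot)).union (hV.image2 hn .all)).union
    (hV.image2 hn .ex)).mono ?_
  rintro A rfl
  cases A <;> simp [Formula.size]

end Countability

/-! ### Henkin sets and their term models -/

section Henkin

variable {L : Language.{u}} {V : Type w}

section Structural

variable {Γ Γ' Δ Δ' : Multiset (Formula L V)} {A : Formula L V}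

theorem Provable.add_left (h : Provable Γ Δ) (Γ' : Multiset (Formula L V)) :
    Provable (Γ' + Γ) Δ := by
  induction Γ' using Multiset.induction_on with
  | empty => rwa [zero_add]
  | cons A Γ' ih => exact Multiset.cons_add A Γ' Γ ▸ .weakLeft ih

theorem Provable.add_right (h : Provable Γ Δ) (Δ' : Multiset (Formula L V)) :
    Provable Γ (Δ' + Δ) := by
  induction Δ' using Multiset.induction_on with
  | empty => rwa [zero_add]
  | cons A Δ' ih => exact Multiset.cons_add A Δ' Δ ▸ .weakRight ih

theorem Provable.contract_left (h : Provable (Γ' + Γ) Δ) (hΓ : Γ' ⊆ Γ) : Provable Γ Δ := by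
  induction Γ' using Multiset.induction_on with
  | empty => rwa [zero_add] at h
  | cons A Γ' ih =>
    rw [Multiset.cons_subset] at hΓ
    refine ih ?_ hΓ.2
    obtain ⟨Θ, hΘ⟩ := Multiset.exists_cons_of_mem (Multiset.mem_add.2 (Or.inr hΓ.1) : A ∈ Γ' + Γ)
    rw [Multiset.cons_add, hΘ] at h
    exact hΘ ▸ .contrLeft h

theorem Provable.contract_right (h : Provable Γ (Δ' + Δ)) (hΔ : Δ' ⊆ Δ) : Provable Γ Δ := by
  induction Δ' using Multiset.induction_on with
  | empty => rwa [zero_add] at h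
  | cons A Δ' ih =>
    rw [Multiset.cons_subset] at hΔ
    refine ih ?_ hΔ.2
    obtain ⟨Θ, hΘ⟩ := Multiset.exists_cons_of_mem (Multiset.mem_add.2 (Or.inr hΔ.1) : A ∈ Δ' + Δ)
    rw [Multiset.cons_add, hΘ] at h
    exact hΘ ▸ .contrRight h

theorem Provable.mono (h : Provable Γ Δ) (hΓ : Γ ⊆ Γ') (hΔ : Δ ⊆ Δ') : Provable Γ' Δ' := by
  have h := (h.add_left Γ').add_right Δ'
  rw [add_comm Γ', add_comm Δ'] at h
  exact (h.contract_left hΓ).contract_right hΔ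

theorem Provable.of_mem (hΓ : A ∈ Γ) (hΔ : A ∈ Δ) : Provable Γ Δ :=
  (Provable.ax A).mono (Multiset.singleton_subset.2 hΓ) (Multiset.singleton_subset.2 hΔ)

theorem exists_fresh [Infinite V] (Γ : Multiset (Formula L V)) : ∃ c, ∀ A ∈ Γ, c ∉ A.vars := by
  have hfin : (⋃ A ∈ {A | A ∈ Γ}, A.vars).Finite :=
    (Multiset.finite_toSet Γ).biUnion fun A _ => A.finite_vars
  simpa only [Set.mem_iUnion, not_exists, Set.mem_ofPred_eq] using hfin.exists_notMem

theorem rel_alpha_refl [Infinite V] (Γ : Multiset (Formula L V)) :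
    Multiset.Rel Formula.Alpha Γ Γ :=
  Multiset.rel_refl_of_refl_on fun A _ => .refl A

end Structural

section Extension

variable [Infinite V] {Γ Δ : Multiset (Formula L V)}

theorem exists_witness_of_not_provable {x : V} {A : Formula L V}
    (h : ¬ Provable (.ex x A ::ₘ Γ) Δ) :
    ∃ c ∉ A.vars, ¬ Provable (A.graft (renameMap ![c] ![x]) ::ₘ .ex x A ::ₘ Γ) Δ := by
  obtain ⟨c, hc⟩ := exists_fresh (.ex x A ::ₘ (Γ + Δ))
  obtain ⟨hex, hΓΔ⟩ := Multiset.forall_mem_cons.1 hc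
  have hA : c ∉ A.vars := fun hA => hex (Or.inr hA)
  refine ⟨c, hA, fun hp => h ?_⟩
  have hp := Provable.exLeft
    (Multiset.forall_mem_cons.2 ⟨fun hc => hex (Formula.freeVars_subset_vars _ hc),
      fun B hB hc => hΓΔ B (Multiset.mem_add.2 (Or.inl hB)) (B.freeVars_subset_vars hc)⟩)
    (fun B hB hc => hΓΔ B (Multiset.mem_add.2 (Or.inr hB)) (B.freeVars_subset_vars hc)) hp
  exact .contrLeft (.alpha (.cons (A.alpha_ex x hA) (rel_alpha_refl _)) (rel_alpha_refl _) hp)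

theorem exists_counterexample_of_not_provable {x : V} {A : Formula L V}
    (h : ¬ Provable Γ (.all x A ::ₘ Δ)) :
    ∃ c ∉ A.vars, ¬ Provable Γ (A.graft (renameMap ![c] ![x]) ::ₘ .all x A ::ₘ Δ) := by
  obtain ⟨c, hc⟩ := exists_fresh (.all x A ::ₘ (Γ + Δ))
  obtain ⟨hall, hΓΔ⟩ := Multiset.forall_mem_cons.1 hc
  have hA : c ∉ A.vars := fun hA => hall (Or.inr hA)
  refine ⟨c, hA, fun hp => h ?_⟩
  have hp := Provable.allRight
    (fun B hB hc => hΓΔ B (Multiset.mem_add.2 (Or.inl hB)) (B.freeVars_subset_vars hc))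
    (Multiset.forall_mem_cons.2 ⟨fun hc => hall (Formula.freeVars_subset_vars _ hc),
      fun B hB hc => hΓΔ B (Multiset.mem_add.2 (Or.inr hB)) (B.freeVars_subset_vars hc)⟩) hp
  exact .contrRight (.alpha (rel_alpha_refl _) (.cons (A.alpha_all x hA) (rel_alpha_refl _)) hp)

/-- The unprovable sequents, ordered by inclusion. -/
abbrev UnprovableSequent (L : Language.{u}) (V : Type w) :=
  {s : Multiset (Formula L V) × Multiset (Formula L V) // ¬ Provable s.1 s.2}

/-- The sequent `s` has `A` on the left, with a witness if `A` is existential, or on the right, with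
a counterexample if `A` is universal. -/
def UnprovableSequent.Decides (s : UnprovableSequent L V) (A : Formula L V) : Prop :=
  (A ∈ s.1.1 ∧ ∀ x B, A = .ex x B → ∃ c ∉ B.vars, B.graft (renameMap ![c] ![x]) ∈ s.1.1) ∨
    (A ∈ s.1.2 ∧ ∀ x B, A = .all x B → ∃ c ∉ B.vars, B.graft (renameMap ![c] ![x]) ∈ s.1.2)

theorem UnprovableSequent.exists_le_decides_of_left {A : Formula L V}
    (h : ¬ Provable (A ::ₘ Γ) Δ) :
    ∃ s : UnprovableSequent L V, (Γ, Δ) ≤ s.1 ∧ s.Decides A := by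
  cases A with
  | ex x A =>
    obtain ⟨c, hc, hp⟩ := exists_witness_of_not_provable h
    refine ⟨⟨(_ ::ₘ _ ::ₘ Γ, Δ), hp⟩,
      ⟨(Multiset.le_cons_self _ _).trans (Multiset.le_cons_self _ _), le_rfl⟩, Or.inl ⟨by simp, ?_⟩⟩
    rintro _ _ ⟨⟩
    exact ⟨c, hc, Multiset.mem_cons_self _ _⟩
  | _ =>
    exact ⟨⟨(_ ::ₘ Γ, Δ), h⟩, ⟨Multiset.le_cons_self _ _, le_rfl⟩,
      Or.inl ⟨Multiset.mem_cons_self _ _, nofun⟩⟩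

theorem UnprovableSequent.exists_le_decides_of_right {A : Formula L V}
    (h : ¬ Provable Γ (A ::ₘ Δ)) :
    ∃ s : UnprovableSequent L V, (Γ, Δ) ≤ s.1 ∧ s.Decides A := by
  cases A with
  | all x A =>
    obtain ⟨c, hc, hp⟩ := exists_counterexample_of_not_provable h
    refine ⟨⟨(Γ, _ ::ₘ _ ::ₘ Δ), hp⟩,
      ⟨le_rfl, (Multiset.le_cons_self _ _).trans (Multiset.le_cons_self _ _)⟩, Or.inr ⟨by simp, ?_⟩⟩
    rintro _ _ ⟨⟩
    exact ⟨c, hc, Multiset.mem_cons_self _ _⟩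
  | _ =>
    exact ⟨⟨(Γ, _ ::ₘ Δ), h⟩, ⟨le_rfl, Multiset.le_cons_self _ _⟩,
      Or.inr ⟨Multiset.mem_cons_self _ _, nofun⟩⟩

theorem UnprovableSequent.isCofinal_decides (A : Formula L V) :
    IsCofinal {s : UnprovableSequent L V | s.Decides A} := by
  intro s
  by_cases hA : Provable (A ::ₘ s.1.1) s.1.2
  · obtain ⟨s', hs, hd⟩ := exists_le_decides_of_right fun hA' => s.2 (.cut A hA hA')
    exact ⟨s', hd, hs⟩
  · obtain ⟨s', hs, hd⟩ := exists_le_decides_of_left hA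
    exact ⟨s', hd, hs⟩

end Extension

/-- A set of propositions that is consistent, in that no provable sequent leads from it to its
complement, and that has witnesses and counterexamples: a candidate for the set of the propositions
that are true in a model. -/
structure IsHenkin (T : Set (Formula L V)) : Prop where
  not_provable {Γ Δ : Multiset (Formula L V)} :
    (∀ A ∈ Γ, A ∈ T) → (∀ A ∈ Δ, A ∉ T) → ¬ Provable Γ Δ
  exists_witness {x : V} {A : Formula L V} :
    .ex x A ∈ T → ∃ c ∉ A.vars, A.graft (renameMap ![c] ![x]) ∈ T
  exists_counterexample {x : V} {A : Formula L V} :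
    .all x A ∉ T → ∃ c ∉ A.vars, A.graft (renameMap ![c] ![x]) ∉ T

theorem exists_mem_ideal_subset {α P : Type*} [Preorder P] {I : Order.Ideal P} {f : P → Multiset α}
    (hf : Monotone f) {Θ : Multiset α} (h : ∀ a ∈ Θ, ∃ s ∈ I, a ∈ f s) : ∃ s ∈ I, Θ ⊆ f s := by
  induction Θ using Multiset.induction_on with
  | empty => exact I.nonempty.imp fun s hs => ⟨hs, Multiset.zero_subset _⟩
  | cons a Θ ih =>
    obtain ⟨⟨s, hs, ha⟩, hΘ⟩ := Multiset.forall_mem_cons.1 h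
    obtain ⟨t, ht, hΘt⟩ := ih hΘ
    obtain ⟨r, hr, hsr, htr⟩ := I.directed s hs t ht
    exact ⟨r, hr, Multiset.cons_subset.2 ⟨Multiset.mem_of_le (hf hsr) ha,
      fun b hb => Multiset.mem_of_le (hf htr) (hΘt hb)⟩⟩

namespace UnprovableSequent

variable {I : Order.Ideal (UnprovableSequent L V)}

theorem not_provable_of_ideal {Γ Δ : Multiset (Formula L V)} (hΓ : ∀ A ∈ Γ, ∃ s ∈ I, A ∈ s.1.1)
    (hΔ : ∀ A ∈ Δ, ∃ s ∈ I, A ∈ s.1.2) : ¬ Provable Γ Δ := by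
  intro hp
  obtain ⟨s, hs, hΓs⟩ :=
    exists_mem_ideal_subset (f := fun s : UnprovableSequent L V => s.1.1)
      (monotone_fst.comp (Subtype.mono_coe _)) hΓ
  obtain ⟨t, ht, hΔt⟩ :=
    exists_mem_ideal_subset (f := fun s : UnprovableSequent L V => s.1.2)
      (monotone_snd.comp (Subtype.mono_coe _)) hΔ
  obtain ⟨r, -, hsr, htr⟩ := I.directed s hs t ht
  exact r.2 (hp.mono (fun _ h => Multiset.mem_of_le hsr.1 (hΓs h))
    fun _ h => Multiset.mem_of_le htr.2 (hΔt h))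

theorem notMem_of_mem_ideal {A : Formula L V} (h : ∃ s ∈ I, A ∈ s.1.1) :
    ¬ ∃ s ∈ I, A ∈ s.1.2 := fun h' =>
  not_provable_of_ideal (Γ := {A}) (Δ := {A}) (by simpa using h) (by simpa using h') (.ax A)

theorem isHenkin_of_ideal (hI : ∀ A, ∃ s ∈ I, s.Decides A) :
    IsHenkin {A | ∃ s ∈ I, A ∈ s.1.1} := by
  have mem_right {A} (hA : A ∉ {A | ∃ s ∈ I, A ∈ s.1.1}) : ∃ s ∈ I, A ∈ s.1.2 := by
    obtain ⟨s, hs, hleft | hright⟩ := hI A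
    · exact absurd ⟨s, hs, hleft.1⟩ hA
    · exact ⟨s, hs, hright.1⟩
  refine ⟨fun hΓ hΔ => not_provable_of_ideal hΓ fun A hA => mem_right (hΔ A hA),
    fun {x A} hA => ?_, fun {x A} hA => ?_⟩
  · obtain ⟨s, hs, ⟨-, hw⟩ | ⟨hright, -⟩⟩ := hI (.ex x A)
    · exact (hw x A rfl).imp fun c hc => ⟨hc.1, s, hs, hc.2⟩
    · exact absurd ⟨s, hs, hright⟩ (notMem_of_mem_ideal hA)
  · obtain ⟨s, hs, ⟨hleft, -⟩ | ⟨-, hw⟩⟩ := hI (.all x A)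
    · exact absurd ⟨s, hs, hleft⟩ hA
    · exact (hw x A rfl).imp fun c hc => ⟨hc.1, fun h => notMem_of_mem_ideal h ⟨s, hs, hc.2⟩⟩

end UnprovableSequent

theorem exists_isHenkin [Infinite V] [Countable (Formula L V)] {Γ Δ : Multiset (Formula L V)}
    (h : ¬ Provable Γ Δ) :
    ∃ T : Set (Formula L V), IsHenkin T ∧ (∀ A ∈ Γ, A ∈ T) ∧ ∀ A ∈ Δ, A ∉ T := by
  have := Encodable.ofCountable (Formula L V)
  let s : UnprovableSequent L V := ⟨(Γ, Δ), h⟩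
  let 𝒟 (A : Formula L V) : Order.Cofinal (UnprovableSequent L V) :=
    ⟨_, UnprovableSequent.isCofinal_decides A⟩
  have hs := Order.mem_idealOfCofinals s 𝒟
  refine ⟨_, UnprovableSequent.isHenkin_of_ideal (I := Order.idealOfCofinals s 𝒟) fun A => ?_,
    fun A hA => ⟨s, hs, hA⟩, fun A hA h => UnprovableSequent.notMem_of_mem_ideal h ⟨s, hs, hA⟩⟩
  obtain ⟨t, ht, htI⟩ := Order.cofinal_meets_idealOfCofinals s 𝒟 A
  exact ⟨t, htI, ht⟩

namespace IsHenkin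

variable {T : Set (Formula L V)} (h : IsHenkin T) {A B A' : Formula L V}
include h

theorem imp_mem_iff : .imp A B ∈ T ↔ (A ∈ T → B ∈ T) := by
  constructor
  · intro hAB hA
    by_contra hB
    exact h.not_provable (Γ := {.imp A B, A}) (Δ := {B}) (by simp [hAB, hA]) (by simp [hB])
      (.impLeft (.of_mem (A := A) (by simp) (by simp)) (.of_mem (A := B) (by simp) (by simp)))
  · contrapose!
    intro hAB
    constructor
    · by_contra hA
      exact h.not_provable (Γ := 0) (Δ := {.imp A B, A}) (by simp) (by simp [hAB, hA])
        (.impRight (.of_mem (A := A) (by simp) (by simp)))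
    · intro hB
      exact h.not_provable (Γ := {B}) (Δ := {.imp A B}) (by simp [hB]) (by simp [hAB])
        (.impRight (.of_mem (A := B) (by simp) (by simp)))

theorem and_mem_iff : .and A B ∈ T ↔ A ∈ T ∧ B ∈ T := by
  refine ⟨fun hAB => ⟨?_, ?_⟩, fun ⟨hA, hB⟩ => ?_⟩ <;> by_contra hC
  · exact h.not_provable (Γ := {.and A B}) (Δ := {A}) (by simp [hAB]) (by simp [hC])
      (.andLeft (.of_mem (A := A) (by simp) (by simp)))
  · exact h.not_provable (Γ := {.and A B}) (Δ := {B}) (by simp [hAB]) (by simp [hC])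
      (.andLeft (.of_mem (A := B) (by simp) (by simp)))
  · exact h.not_provable (Γ := {A, B}) (Δ := {.and A B}) (by simp [hA, hB]) (by simp [hC])
      (.andRight (.of_mem (A := A) (by simp) (by simp)) (.of_mem (A := B) (by simp) (by simp)))

theorem or_mem_iff : .or A B ∈ T ↔ A ∈ T ∨ B ∈ T := by
  constructor
  · intro hAB
    by_contra! hC
    exact h.not_provable (Γ := {.or A B}) (Δ := {A, B}) (by simp [hAB]) (by simp [hC])
      (.orLeft (.of_mem (A := A) (by simp) (by simp)) (.of_mem (A := B) (by simp) (by simp)))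
  · rintro (hA | hB) <;> by_contra hC
    · exact h.not_provable (Γ := {A}) (Δ := {.or A B}) (by simp [hA]) (by simp [hC])
        (.orRight (.of_mem (A := A) (by simp) (by simp)))
    · exact h.not_provable (Γ := {B}) (Δ := {.or A B}) (by simp [hB]) (by simp [hC])
        (.orRight (.of_mem (A := B) (by simp) (by simp)))

theorem bot_notMem : .bot ∉ T := fun hbot =>
  h.not_provable (Γ := {.bot}) (Δ := 0) (by simp [hbot]) (by simp) .botLeft

theorem mem_of_all_mem {x : V} {t : Term L V} (hA : .all x A ∈ T)
    (hs : Formula.IsSubst t x A A') : A' ∈ T := by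
  by_contra hA'
  exact h.not_provable (Γ := {.all x A}) (Δ := {A'}) (by simp [hA]) (by simp [hA'])
    (.allLeft t hs (.ax A'))

theorem ex_mem_of_mem {x : V} {t : Term L V} (hA' : A' ∈ T) (hs : Formula.IsSubst t x A A') :
    .ex x A ∈ T := by
  by_contra hA
  exact h.not_provable (Γ := {A'}) (Δ := {.ex x A}) (by simp [hA']) (by simp [hA])
    (.exRight t hs (.ax A'))

theorem mem_of_alpha [Infinite V] (hA : A ∈ T) (hα : A.Alpha A') : A' ∈ T := by
  by_contra hA'
  exact h.not_provable (Γ := {A}) (Δ := {A'}) (by simp [hA]) (by simp [hA'])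
    (.alpha (rel_alpha_refl _) (.cons hα .zero) (.ax A))

end IsHenkin

open DeBruijn

/-- The de Bruijn terms as a model in which an atom is true when `T` contains a representative
of it. -/
abbrev termModel (T : Set (Formula L V)) : BindingModel.{u, max u w} L :=
  (deBruijnModel L V).withPred fun P ds => ∃ xs ts, .atom P xs ts ∈ T ∧
    ∀ i, (deBruijnModel L V).eval (ts i) ((deBruijnModel L V).ext (p := 0) free (xs.name i)) = ds i

theorem IsHenkin.sat_atom_iff_mem [Infinite V] {T : Set (Formula L V)} (h : IsHenkin T) (P : L.Pred)
    (xs : Binders (L.predArity P) V) (ts : Fin (L.predArity P).length → Term L V) :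
    (termModel T).Sat free (.atom P xs ts) ↔ .atom P xs ts ∈ T := by
  have heval (i) : (termModel T).eval (ts i) ((termModel T).ext (p := 0) free (xs.name i)) =
      (deBruijnModel L V).eval (ts i) ((deBruijnModel L V).ext (p := 0) free (xs.name i)) :=
    BindingModel.eval_withPred ..
  rw [BindingModel.sat_atom]
  constructor
  · rintro ⟨xs', ts', hmem, heq⟩
    exact h.mem_of_alpha hmem (Formula.alpha_atom_of_eval_eq fun i => (heq i).trans (heval i))
  · exact fun hmem => ⟨xs, ts, hmem, fun i => (heval i).symm⟩

open scoped Classical in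
theorem exists_isSubst_sat_iff [Infinite V] (T : Set (Formula L V)) (x : V) (A : Formula L V)
    (d : DeBruijn L V 0) : ∃ t A', Formula.IsSubst t x A A' ∧
      ((termModel T).Sat free A' ↔ (termModel T).Sat (Function.update free x d) A) := by
  obtain ⟨t, ht⟩ := d.exists_eval_eq (ρ := free) (fun i => i.elim0) fun z _ => ⟨z, rfl⟩
  obtain ⟨A', hA'⟩ := A.exists_isSubst t x
  refine ⟨t, A', hA', ?_⟩
  rw [(termModel T).sat_isSubst hA', ← ht, BindingModel.eval_withPred]

theorem IsHenkin.sat_iff_mem [Infinite V] {T : Set (Formula L V)} (h : IsHenkin T)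
    (A : Formula L V) : (termModel T).Sat free A ↔ A ∈ T := by
  induction A using Formula.size_induction with
  | atom P xs ts => exact h.sat_atom_iff_mem P xs ts
  | imp A B ihA ihB => exact (imp_congr ihA ihB).trans h.imp_mem_iff.symm
  | and A B ihA ihB => exact (and_congr ihA ihB).trans h.and_mem_iff.symm
  | or A B ihA ihB => exact (or_congr ihA ihB).trans h.or_mem_iff.symm
  | bot => exact iff_of_false id h.bot_notMem
  | all x A ih =>
    constructor
    · contrapose!
      intro hA hsat
      obtain ⟨c, hc, hAc⟩ := h.exists_counterexample hA
      rw [← ih _ (A.size_graft _), BindingModel.sat_graft_renameMap _ _ _ hc] at hAc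
      exact hAc (hsat (free c))
    · intro hA d
      obtain ⟨t, A', hA', hiff⟩ := exists_isSubst_sat_iff T x A d
      exact hiff.1 ((ih A' hA'.size_eq).2 (h.mem_of_all_mem hA hA'))
  | ex x A ih =>
    constructor
    · rintro ⟨d, hd⟩
      obtain ⟨t, A', hA', hiff⟩ := exists_isSubst_sat_iff T x A d
      exact h.ex_mem_of_mem ((ih A' hA'.size_eq).1 (hiff.2 hd)) hA'
    · intro hA
      obtain ⟨c, hc, hAc⟩ := h.exists_witness hA
      rw [← ih _ (A.size_graft _), BindingModel.sat_graft_renameMap _ _ _ hc] at hAc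
      exact ⟨free c, hAc⟩

end Henkin

/-! ### Sublanguages -/

section Sublanguage

universe w'

/-- The sublanguage of `L` whose function and predicate symbols are those in `S`. -/
abbrev Language.sub (L : Language.{u}) (S : Set (L.Func ⊕ L.Pred)) : Language.{u} where
  Func := {f : L.Func // .inl f ∈ S}
  Pred := {P : L.Pred // .inr P ∈ S}
  funcArity f := L.funcArity f
  predArity P := L.predArity P

variable {L : Language.{u}} {S : Set (L.Func ⊕ L.Pred)} {V : Type w} {W : Type w'}

/-- The function symbols that occur in a term. -/
def Term.symbols : Term L V → Set (L.Func ⊕ L.Pred)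
  | .var _ => ∅
  | .app f _ ts => {.inl f} ∪ ⋃ i, (ts i).symbols

/-- The function and predicate symbols that occur in a proposition. -/
def Formula.symbols : Formula L V → Set (L.Func ⊕ L.Pred)
  | .atom P _ ts => {.inr P} ∪ ⋃ i, (ts i).symbols
  | .imp A B => A.symbols ∪ B.symbols
  | .and A B => A.symbols ∪ B.symbols
  | .or A B => A.symbols ∪ B.symbols
  | .bot => ∅
  | .all _ A => A.symbols
  | .ex _ A => A.symbols

theorem Term.finite_symbols (t : Term L V) : t.symbols.Finite := by
  induction t with
  | var _ => exact Set.finite_empty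
  | app f _ ts ih => exact (Set.finite_singleton _).union (Set.finite_iUnion ih)

theorem Formula.finite_symbols (A : Formula L V) : A.symbols.Finite := by
  induction A with
  | atom P _ ts =>
    exact (Set.finite_singleton _).union (Set.finite_iUnion fun i => (ts i).finite_symbols)
  | imp A B ihA ihB => exact ihA.union ihB
  | and A B ihA ihB => exact ihA.union ihB
  | or A B ihA ihB => exact ihA.union ihB
  | bot => exact Set.finite_empty
  | all _ _ ih => exact ih
  | ex _ _ ih => exact ih

section Map

variable {ι : W → V} (hι : Function.Injective ι)

/-- The binders whose names are the images of those of `xs` under an injection. -/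
def Binders.map {k : List ℕ} (xs : Binders k W) : Binders k V where
  name i j := ι (xs.name i j)
  distinct := hι.comp xs.distinct

/-- The embedding of the terms of a sublanguage, along an injection of the variables. -/
def Term.map : Term (L.sub S) W → Term L V
  | .var x => .var (ι x)
  | .app f xs ts => .app f.1 (xs.map hι) fun i => (ts i).map

/-- The embedding of the propositions of a sublanguage, along an injection of the variables. -/
def Formula.map : Formula (L.sub S) W → Formula L V
  | .atom P xs ts => .atom P.1 (xs.map hι) fun i => (ts i).map hι
  | .imp A B => .imp A.map B.map
  | .and A B => .and A.map B.map
  | .or A B => .or A.map B.map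
  | .bot => .bot
  | .all x A => .all (ι x) A.map
  | .ex x A => .ex (ι x) A.map

theorem Binders.exists_map_eq {k : List ℕ} (xs : Binders k V)
    (h : ∀ i j, xs.name i j ∈ Set.range ι) : ∃ ys : Binders k W, ys.map hι = xs := by
  choose ys hys using h
  refine ⟨⟨ys, fun a b hab => xs.distinct ?_⟩, ?_⟩
  · change xs.name a.1 a.2 = xs.name b.1 b.2
    rw [← hys, ← hys]
    exact congrArg ι hab
  · cases xs
    simp only [Binders.map, hys]

theorem Term.exists_map_eq (t : Term L V) (hS : t.symbols ⊆ S) (hV : t.vars ⊆ Set.range ι) :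
    ∃ s : Term (L.sub S) W, s.map hι = t := by
  induction t with
  | var x =>
    obtain ⟨y, rfl⟩ := hV rfl
    exact ⟨.var y, rfl⟩
  | app f xs ts ih =>
    simp only [symbols, vars, Set.union_subset_iff, Set.singleton_subset_iff, Set.iUnion_subset_iff,
      Set.range_subset_iff, forall_and] at hS hV
    obtain ⟨ys, rfl⟩ := xs.exists_map_eq hι hV.1
    choose ss hss using fun i => ih i (hS.2 i) (hV.2 i)
    exact ⟨.app ⟨f, hS.1⟩ ys ss, congrArg (Term.app f _) (funext hss)⟩

theorem Formula.exists_map_eq (A : Formula L V) (hS : A.symbols ⊆ S) (hV : A.vars ⊆ Set.range ι) :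
    ∃ B : Formula (L.sub S) W, B.map hι = A := by
  induction A with
  | atom P xs ts =>
    simp only [symbols, vars, Set.union_subset_iff, Set.singleton_subset_iff, Set.iUnion_subset_iff,
      Set.range_subset_iff, forall_and] at hS hV
    obtain ⟨ys, rfl⟩ := xs.exists_map_eq hι hV.1
    choose ss hss using fun i => (ts i).exists_map_eq hι (hS.2 i) (hV.2 i)
    exact ⟨.atom ⟨P, hS.1⟩ ys ss, congrArg (Formula.atom P _) (funext hss)⟩
  | imp A B ihA ihB =>
    obtain ⟨A', rfl⟩ := ihA (Set.union_subset_iff.1 hS).1 (Set.union_subset_iff.1 hV).1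
    obtain ⟨B', rfl⟩ := ihB (Set.union_subset_iff.1 hS).2 (Set.union_subset_iff.1 hV).2
    exact ⟨.imp A' B', rfl⟩
  | and A B ihA ihB =>
    obtain ⟨A', rfl⟩ := ihA (Set.union_subset_iff.1 hS).1 (Set.union_subset_iff.1 hV).1
    obtain ⟨B', rfl⟩ := ihB (Set.union_subset_iff.1 hS).2 (Set.union_subset_iff.1 hV).2
    exact ⟨.and A' B', rfl⟩
  | or A B ihA ihB =>
    obtain ⟨A', rfl⟩ := ihA (Set.union_subset_iff.1 hS).1 (Set.union_subset_iff.1 hV).1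
    obtain ⟨B', rfl⟩ := ihB (Set.union_subset_iff.1 hS).2 (Set.union_subset_iff.1 hV).2
    exact ⟨.or A' B', rfl⟩
  | bot => exact ⟨.bot, rfl⟩
  | all x A ih =>
    obtain ⟨y, rfl⟩ := hV (Or.inl rfl)
    obtain ⟨A', rfl⟩ := ih hS (Set.union_subset_iff.1 hV).2
    exact ⟨.all y A', rfl⟩
  | ex x A ih =>
    obtain ⟨y, rfl⟩ := hV (Or.inl rfl)
    obtain ⟨A', rfl⟩ := ih hS (Set.union_subset_iff.1 hV).2
    exact ⟨.ex y A', rfl⟩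

theorem Binders.range_map_name {k : List ℕ} (xs : Binders k W) (i : Fin k.length) :
    Set.range ((xs.map hι).name i) = ι '' Set.range (xs.name i) :=
  Set.range_comp ι (xs.name i)

theorem Term.vars_map (t : Term (L.sub S) W) : (t.map hι).vars = ι '' t.vars := by
  induction t with
  | var x => exact Set.image_singleton.symm
  | app f xs ts ih =>
    simp only [Term.map, Term.vars, Set.image_iUnion, Set.image_union, Binders.range_map_name, ih]

theorem Term.freeVars_map (t : Term (L.sub S) W) : (t.map hι).freeVars = ι '' t.freeVars := by
  induction t with
  | var x => exact Set.image_singleton.symm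
  | app f xs ts ih =>
    simp only [Term.map, Term.freeVars, Set.image_iUnion, Set.image_sdiff hι,
      Binders.range_map_name, ih]

theorem Formula.vars_map (A : Formula (L.sub S) W) : (A.map hι).vars = ι '' A.vars := by
  induction A <;> simp only [Formula.map, Formula.vars, Set.image_iUnion, Set.image_union,
    Binders.range_map_name, Term.vars_map, Set.image_empty, Set.image_singleton, *]

theorem Formula.freeVars_map (A : Formula (L.sub S) W) : (A.map hι).freeVars = ι '' A.freeVars := by
  induction A <;> simp only [Formula.map, Formula.freeVars, Set.image_iUnion, Set.image_union,
    Set.image_sdiff hι, Binders.range_map_name, Term.freeVars_map, Set.image_empty,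
    Set.image_singleton, *]

theorem Term.notMem_vars_map {t : Term (L.sub S) W} {x : W} (h : x ∉ t.vars) :
    ι x ∉ (t.map hι).vars := by
  rwa [vars_map, hι.mem_set_image]

theorem Formula.notMem_vars_map {A : Formula (L.sub S) W} {x : W} (h : x ∉ A.vars) :
    ι x ∉ (A.map hι).vars := by
  rwa [vars_map, hι.mem_set_image]

theorem restrict_map {θ : W → Term (L.sub S) W} {θ' : V → Term L V}
    (h : ∀ x, θ' (ι x) = (θ x).map hι) (R : Set W) (x : W) :
    restrict (ι '' R) θ' (ι x) = (restrict R θ x).map hι := by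
  by_cases hx : x ∈ R
  · rw [restrict, restrict, if_pos hx, if_pos ⟨x, hx, rfl⟩, Term.map]
  · rw [restrict, restrict, if_neg hx, if_neg (by rwa [hι.mem_set_image]), h]

theorem Term.graft_map (t : Term (L.sub S) W) {θ : W → Term (L.sub S) W} {θ' : V → Term L V}
    (h : ∀ x, θ' (ι x) = (θ x).map hι) : (t.map hι).graft θ' = (t.graft θ).map hι := by
  induction t generalizing θ θ' with
  | var x => exact h x
  | app f xs ts ih =>
    refine congrArg (Term.app f.1 _) (funext fun i => ih i ?_)
    rw [Binders.range_map_name]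
    exact restrict_map hι h _

theorem Formula.graft_map (A : Formula (L.sub S) W) {θ : W → Term (L.sub S) W} {θ' : V → Term L V}
    (h : ∀ x, θ' (ι x) = (θ x).map hι) : (A.map hι).graft θ' = (A.graft θ).map hι := by
  induction A generalizing θ θ' with
  | atom P xs ts =>
    refine congrArg (Formula.atom P.1 _) (funext fun i => (ts i).graft_map hι ?_)
    rw [Binders.range_map_name]
    exact restrict_map hι h _
  | imp A B ihA ihB => exact congrArg₂ Formula.imp (ihA h) (ihB h)
  | and A B ihA ihB => exact congrArg₂ Formula.and (ihA h) (ihB h)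
  | or A B ihA ihB => exact congrArg₂ Formula.or (ihA h) (ihB h)
  | bot => rfl
  | all x A ih =>
    refine congrArg (Formula.all (ι x)) (ih ?_)
    rw [← Set.image_singleton]
    exact restrict_map hι h {x}
  | ex x A ih =>
    refine congrArg (Formula.ex (ι x)) (ih ?_)
    rw [← Set.image_singleton]
    exact restrict_map hι h {x}

theorem renameMap_map {k : ℕ} (ys : Fin k → W) {xs : Fin k → W} (hx : Function.Injective xs)
    (z : W) : (renameMap (fun j => ι (ys j)) (fun j => ι (xs j)) (ι z) : Term L V) =
      (renameMap ys xs z : Term (L.sub S) W).map hι := by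
  by_cases hz : z ∈ Set.range xs
  · obtain ⟨j, rfl⟩ := hz
    rw [renameMap_name ys hx, Term.map]
    exact renameMap_name (fun j => ι (ys j)) (hι.comp hx) j
  · rw [renameMap_of_notMem ys hz, Term.map, renameMap_of_notMem]
    rintro ⟨j, hj⟩
    exact hz ⟨j, hι hj⟩

theorem Term.graft_renameMap_map (t : Term (L.sub S) W) {k : ℕ} (ys : Fin k → W) {xs : Fin k → W}
    (hx : Function.Injective xs) :
    (t.map hι).graft (renameMap (fun j => ι (ys j)) fun j => ι (xs j)) =
      (t.graft (renameMap ys xs)).map hι :=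
  t.graft_map hι (renameMap_map hι ys hx)

theorem Formula.graft_renameMap_map (A : Formula (L.sub S) W) (x y : W) :
    (A.map hι).graft (renameMap ![ι y] ![ι x]) = (A.graft (renameMap ![y] ![x])).map hι := by
  refine A.graft_map hι fun z => ?_
  rw [← renameMap_map hι _ (injective_vec_one x)]
  congr 1 <;> exact funext fun j => by rw [Subsingleton.elim j 0]; rfl

theorem Term.Alpha.map {t t' : Term (L.sub S) W} (h : t.Alpha t') :
    (t.map hι).Alpha (t'.map hι) := by
  induction h with
  | var x => exact .var _
  | app f xs xs' ts ts' ys hy fresh _ ih =>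
    refine .app f.1 (xs.map hι) (xs'.map hι) _ _ (fun i j => ι (ys i j)) (fun i => hι.comp (hy i))
      (fun i j => (fresh i j).imp (Term.notMem_vars_map hι) (Term.notMem_vars_map hι)) fun i => ?_
    have hxs := (ts i).graft_renameMap_map hι (ys i) (xs.name_injective i)
    have hxs' := (ts' i).graft_renameMap_map hι (ys i) (xs'.name_injective i)
    exact hxs ▸ hxs' ▸ ih i

theorem Formula.Alpha.map {A A' : Formula (L.sub S) W} (h : A.Alpha A') :
    (A.map hι).Alpha (A'.map hι) := by
  induction h with
  | atom P xs xs' ts ts' ys hy fresh h =>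
    refine .atom P.1 (xs.map hι) (xs'.map hι) _ _ (fun i j => ι (ys i j)) (fun i => hι.comp (hy i))
      (fun i j => (fresh i j).imp (Term.notMem_vars_map hι) (Term.notMem_vars_map hι)) fun i => ?_
    have hxs := (ts i).graft_renameMap_map hι (ys i) (xs.name_injective i)
    have hxs' := (ts' i).graft_renameMap_map hι (ys i) (xs'.name_injective i)
    exact hxs ▸ hxs' ▸ (h i).map hι
  | imp _ _ ihA ihB => exact .imp ihA ihB
  | and _ _ ihA ihB => exact .and ihA ihB
  | or _ _ ihA ihB => exact .or ihA ihB
  | bot => exact .bot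
  | all x x' y A A' fresh _ ih =>
    refine .all _ _ (ι y) _ _
      (fresh.imp (Formula.notMem_vars_map hι) (Formula.notMem_vars_map hι)) ?_
    rwa [A.graft_renameMap_map, A'.graft_renameMap_map]
  | ex x x' y A A' fresh _ ih =>
    refine .ex _ _ (ι y) _ _
      (fresh.imp (Formula.notMem_vars_map hι) (Formula.notMem_vars_map hι)) ?_
    rwa [A.graft_renameMap_map, A'.graft_renameMap_map]

theorem Term.IsSubst.map {t : Term (L.sub S) W} {x : W} {u u' : Term (L.sub S) W}
    (h : Term.IsSubst t x u u') : Term.IsSubst (t.map hι) (ι x) (u.map hι) (u'.map hι) := by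
  induction h with
  | var_self => exact .var_self
  | var_other z h => exact .var_other _ (hι.ne h)
  | app f xs ys us us' fresh _ ih =>
    refine .app f.1 (xs.map hι) (ys.map hι) _ _ (fun i j => (fresh i j).imp
      (Term.notMem_vars_map hι) (And.imp (Term.notMem_vars_map hι) hι.ne)) fun i => ?_
    exact (us i).graft_renameMap_map hι (ys.name i) (xs.name_injective i) ▸ ih i

theorem Formula.IsSubst.map {t : Term (L.sub S) W} {x : W} {A A' : Formula (L.sub S) W}
    (h : Formula.IsSubst t x A A') :
    Formula.IsSubst (t.map hι) (ι x) (A.map hι) (A'.map hι) := by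
  induction h with
  | atom P xs ys us us' fresh h =>
    refine .atom P.1 (xs.map hι) (ys.map hι) _ _ (fun i j => (fresh i j).imp
      (Formula.notMem_vars_map hι) (And.imp (Term.notMem_vars_map hι) hι.ne)) fun i => ?_
    exact (us i).graft_renameMap_map hι (ys.name i) (xs.name_injective i) ▸ (h i).map hι
  | imp _ _ ihA ihB => exact .imp ihA ihB
  | and _ _ ihA ihB => exact .and ihA ihB
  | or _ _ ihA ihB => exact .or ihA ihB
  | bot => exact .bot
  | all z y A A' fresh _ ih =>
    refine .all _ (ι y) _ _
      (fresh.imp (Formula.notMem_vars_map hι) (And.imp (Term.notMem_vars_map hι) hι.ne)) ?_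
    rwa [A.graft_renameMap_map]
  | ex z y A A' fresh _ ih =>
    refine .ex _ (ι y) _ _
      (fresh.imp (Formula.notMem_vars_map hι) (And.imp (Term.notMem_vars_map hι) hι.ne)) ?_
    rwa [A.graft_renameMap_map]

theorem Provable.map {Γ Δ : Multiset (Formula (L.sub S) W)} (h : Provable Γ Δ) :
    Provable (Γ.map (Formula.map hι)) (Δ.map (Formula.map hι)) := by
  have rel_map {Γ Γ' : Multiset (Formula (L.sub S) W)} (h : Multiset.Rel Formula.Alpha Γ Γ') :
      Multiset.Rel Formula.Alpha (Γ.map (Formula.map hι)) (Γ'.map (Formula.map hι)) :=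
    Multiset.rel_map.2 (h.mono fun _ _ _ _ h => h.map hι)
  have fresh_map {Γ : Multiset (Formula (L.sub S) W)} {x : W} (h : ∀ B ∈ Γ, x ∉ B.freeVars) :
      ∀ B ∈ Γ.map (Formula.map hι), ι x ∉ B.freeVars := by
    intro _ hB
    obtain ⟨A, hA, rfl⟩ := Multiset.mem_map.1 hB
    rw [Formula.freeVars_map, hι.mem_set_image]
    exact h A hA
  induction h with
  | alpha hΓ hΔ _ ih => exact .alpha (rel_map hΓ) (rel_map hΔ) ih
  | ax A => exact .ax (A.map hι)
  | _ => ?_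
  all_goals simp only [Multiset.map_cons, Formula.map] at *
  case cut ihl ihr => exact .cut _ ihl ihr
  case contrLeft ih => exact .contrLeft ih
  case contrRight ih => exact .contrRight ih
  case weakLeft ih => exact .weakLeft ih
  case weakRight ih => exact .weakRight ih
  case impLeft ihA ihB => exact .impLeft ihA ihB
  case impRight ih => exact .impRight ih
  case andLeft ih => exact .andLeft ih
  case andRight ihA ihB => exact .andRight ihA ihB
  case orLeft ihA ihB => exact .orLeft ihA ihB
  case orRight ih => exact .orRight ih
  case botLeft => exact .botLeft
  case allLeft t hs _ ih => exact .allLeft _ (hs.map hι) ih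
  case allRight hΓ hΔ _ ih => exact .allRight (fresh_map hΓ) (fresh_map hΔ) ih
  case exLeft hΓ hΔ _ ih => exact .exLeft (fresh_map hΓ) (fresh_map hΔ) ih
  case exRight t hs _ ih => exact .exRight _ (hs.map hι) ih

end Map

namespace BindingModel

variable (M : BindingModel.{u, v} (L.sub S)) (c : M.carrier 0)

open scoped Classical in
/-- The expansion of a model of a sublanguage to a model of the whole language, in which the other
function symbols denote the constant `c` and the other predicate symbols are false. -/
noncomputable abbrev expand : BindingModel.{u, v} L where
  toIntensionalStructure := M.toIntensionalStructure
  func f p a := if h : .inl f ∈ S then M.func ⟨f, h⟩ p a else M.comp c Fin.elim0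
  func_comp f p q a b := by
    by_cases h : .inl f ∈ S
    · rw [dif_pos h, dif_pos h]
      exact M.func_comp ⟨f, h⟩ p q a b
    · rw [dif_neg h, dif_neg h]
      exact (M.comp_assoc c _ b).trans (congrArg (M.comp c) (Subsingleton.elim _ _))
  pred P a := ∃ h : .inr P ∈ S, M.pred ⟨P, h⟩ a

variable {ι : W → V} (hι : Function.Injective ι)
include hι

theorem ext_expand {p k : ℕ} (ρ : V → M.carrier p) {ys : Fin k → W}
    (hy : Function.Injective ys) (x : W) :
    (M.expand c).ext ρ (fun j => ι (ys j)) (ι x) = M.ext (fun z => ρ (ι z)) ys x := by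
  by_cases hx : x ∈ Set.range ys
  · obtain ⟨j, rfl⟩ := hx
    rw [M.ext_name _ hy]
    exact (M.expand c).ext_name ρ (hι.comp hy) j
  · rw [M.ext_of_notMem _ hx, BindingModel.ext_of_notMem]
    rintro ⟨j, hj⟩
    exact hx ⟨j, hι hj⟩

theorem eval_expand (t : Term (L.sub S) W) {p : ℕ} (ρ : V → M.carrier p) :
    (M.expand c).eval (t.map hι) ρ = M.eval t fun x => ρ (ι x) := by
  induction t generalizing p with
  | var x => rfl
  | app f xs ts ih =>
    refine (dif_pos f.2).trans (congrArg (M.func f p) (funext fun i => (ih i _).trans ?_))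
    exact congrArg (M.eval (ts i)) (funext (M.ext_expand c hι ρ (xs.name_injective i)))

theorem sat_expand (A : Formula (L.sub S) W) (φ : V → M.carrier 0) :
    (M.expand c).Sat φ (A.map hι) ↔ M.Sat (fun x => φ (ι x)) A := by
  classical
  induction A generalizing φ with
  | atom P xs ts =>
    have heval (i) : (M.expand c).eval ((ts i).map hι) ((M.expand c).ext φ ((xs.map hι).name i)) =
        M.eval (ts i) (M.ext (fun x => φ (ι x)) (xs.name i)) :=
      (M.eval_expand c hι (ts i) _).trans
        (congrArg (M.eval (ts i)) (funext (M.ext_expand c hι φ (xs.name_injective i))))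
    rw [Formula.map, sat_atom, sat_atom, funext heval]
    exact exists_prop_of_true P.2
  | imp A B ihA ihB => exact imp_congr (ihA φ) (ihB φ)
  | and A B ihA ihB => exact and_congr (ihA φ) (ihB φ)
  | or A B ihA ihB => exact or_congr (ihA φ) (ihB φ)
  | bot => exact Iff.rfl
  | all x A ih =>
    refine forall_congr' fun a => (ih _).trans ?_
    rw [← Function.comp_def, Function.update_comp_eq_of_injective φ hι, Function.comp_def]
  | ex x A ih =>
    refine exists_congr fun a => (ih _).trans ?_
    rw [← Function.comp_def, Function.update_comp_eq_of_injective φ hι, Function.comp_def]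

theorem satSequent_expand {Γ Δ : Multiset (Formula (L.sub S) W)} {φ : V → M.carrier 0} :
    (M.expand c).SatSequent φ (Γ.map (Formula.map hι)) (Δ.map (Formula.map hι)) ↔
      M.SatSequent (fun x => φ (ι x)) Γ Δ := by
  simp only [SatSequent, Multiset.mem_map, forall_exists_index, and_imp, forall_apply_eq_imp_iff₂,
    exists_exists_and_eq_and, M.sat_expand c hι]

end BindingModel

end Sublanguage

/-! ### Completeness -/

section Completeness

variable {L : Language.{u}} {V : Type w} {Γ Δ : Multiset (Formula L V)}

theorem exists_not_satSequent_of_countable [Infinite V] [Countable (Formula L V)]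
    (h : ¬ Provable Γ Δ) : ∃ (M : BindingModel.{u, max u w} L) (φ : V → M.carrier 0),
      ¬ M.SatSequent φ Γ Δ := by
  obtain ⟨T, hT, hΓ, hΔ⟩ := exists_isHenkin h
  refine ⟨termModel T, DeBruijn.free, fun hsat => ?_⟩
  obtain ⟨B, hB, hBT⟩ := hsat fun A hA => (hT.sat_iff_mem A).2 (hΓ A hA)
  exact hΔ B hB ((hT.sat_iff_mem B).1 hBT)

theorem exists_countable_symbols_vars [Infinite V] (Γ : Multiset (Formula L V)) :
    ∃ (S : Set (L.Func ⊕ L.Pred)) (X : Set V), S.Countable ∧ X.Countable ∧ X.Infinite ∧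
      ∀ A ∈ Γ, A.symbols ⊆ S ∧ A.vars ⊆ X := by
  have hfin := Multiset.finite_toSet Γ
  let e := Infinite.natEmbedding V
  refine ⟨⋃ A ∈ {A | A ∈ Γ}, A.symbols, (⋃ A ∈ {A | A ∈ Γ}, A.vars) ∪ Set.range e,
    (hfin.biUnion fun A _ => A.finite_symbols).countable,
    (hfin.biUnion fun A _ => A.finite_vars).countable.union (Set.countable_range e),
    (Set.infinite_range_of_injective e.injective).mono Set.subset_union_right, fun A hA => ?_⟩
  have hA : A ∈ {A | A ∈ Γ} := hA
  exact ⟨Set.subset_biUnion_of_mem (u := Formula.symbols) hA,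
    (Set.subset_biUnion_of_mem (u := Formula.vars) hA).trans Set.subset_union_left⟩

theorem exists_not_satSequent [Infinite V] (h : ¬ Provable Γ Δ) :
    ∃ (M : BindingModel.{u, max u v w} L) (φ : V → M.carrier 0), ¬ M.SatSequent φ Γ Δ := by
  obtain ⟨S, X, hS, hX, hXinf, hsub⟩ := exists_countable_symbols_vars (Γ + Δ)
  have := hX.to_subtype
  have := hXinf.to_subtype
  let ι : ULift.{v} X → V := fun x => x.down
  have hι : Function.Injective ι := Subtype.val_injective.comp ULift.down_injective
  have : CanLift (Formula L V) (Formula (L.sub S) (ULift.{v} X)) (Formula.map hι)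
      fun A => A.symbols ⊆ S ∧ A.vars ⊆ X :=
    ⟨fun A hA => A.exists_map_eq hι hA.1 fun x hx => ⟨⟨x, hA.2 hx⟩, rfl⟩⟩
  lift Γ to Multiset (Formula (L.sub S) (ULift.{v} X)) using
    fun A hA => hsub A (Multiset.mem_add.2 (Or.inl hA))
  lift Δ to Multiset (Formula (L.sub S) (ULift.{v} X)) using
    fun A hA => hsub A (Multiset.mem_add.2 (Or.inr hA))
  have : Countable (L.sub S).Func := (hS.preimage Sum.inl_injective).to_subtype
  have : Countable (L.sub S).Pred := (hS.preimage Sum.inr_injective).to_subtype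
  obtain ⟨M, φ, hφ⟩ := exists_not_satSequent_of_countable fun h' => h (h'.map hι)
  obtain ⟨x⟩ : Nonempty (ULift.{v} X) := inferInstance
  refine ⟨M.expand (φ x), φ ∘ Function.invFun ι, ?_⟩
  rw [M.satSequent_expand _ hι]
  simpa only [Function.comp_apply, Function.leftInverse_invFun hι _] using hφ

theorem provable_iff_satSequent [Infinite V] : Provable Γ Δ ↔
    ∀ (M : BindingModel.{u, max u v w} L) (φ : V → M.carrier 0), M.SatSequent φ Γ Δ := by
  refine ⟨fun h M => h.sound M, fun h => ?_⟩
  by_contra hp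
  obtain ⟨M, φ, hφ⟩ := exists_not_satSequent.{u, v, w} hp
  exact hφ (h M φ)

theorem BindingModel.valid_iff_sat (M : BindingModel.{u, v} L) {A : Formula L V}
    (hA : A.freeVars = ∅) (φ : V → M.carrier 0) : M.Valid A ↔ M.Sat φ A :=
  ⟨fun h => h φ, fun h ψ => (M.sat_congr A (by simp [hA])).1 h⟩

end Completeness

end BindingLogic

theorem mainTheorem1 (L : BindingLogic.Language.{u}) (V : Type w) [Infinite V]
    (Γ Δ : Multiset (BindingLogic.Formula L V)) :
    (BindingLogic.Provable Γ Δ ↔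
      ∀ (M : BindingLogic.BindingModel.{u, max u v w} L) (φ : V → M.carrier 0),
        (∀ A ∈ Γ, M.Sat φ A) → ∃ B ∈ Δ, M.Sat φ B) ∧
    ((∀ A ∈ Γ + Δ, A.freeVars = ∅) →
      (BindingLogic.Provable Γ Δ ↔
        ∀ M : BindingLogic.BindingModel.{u, max u v w} L, Nonempty (M.carrier 0) →
          (∀ A ∈ Γ, M.Valid A) → ∃ B ∈ Δ, M.Valid B)) := by
  have main := BindingLogic.provable_iff_satSequent.{u, v, w} (Γ := Γ) (Δ := Δ)
  refine ⟨main, fun hclosed => main.trans ⟨fun h M ⟨a⟩ hΓ => ?_, fun h M φ hΓ => ?_⟩⟩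
  · obtain ⟨B, hB, hsat⟩ := h M (fun _ => a) fun A hA => hΓ A hA _
    exact ⟨B, hB, (M.valid_iff_sat (hclosed B (Multiset.mem_add.2 (Or.inr hB))) _).2 hsat⟩
  · obtain ⟨x⟩ : Nonempty V := inferInstance
    obtain ⟨B, hB, hvalid⟩ := h M ⟨φ x⟩ fun A hA =>
      (M.valid_iff_sat (hclosed A (Multiset.mem_add.2 (Or.inl hA))) φ).2 (hΓ A hA)
    exact ⟨B, hB, hvalid φ⟩
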